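/- Let $0<r<1$. Let $\mathbb T$ be the unit circle with normalized Lebesgue measure $\frac{dt}{2\pi}$, and let $L^r(\mathbb T)$ be the space of (classes of) measurable functions $f:\mathbb T\to\mathbb C$ with $\int|f|^r<\infty$, with the metric $d(f,g)=\frac1{2\pi}\int_0^{2\pi}|f(e^{it})-g(e^{it})|^r\,dt$. Let $H^r(\mathbb D)$ be the space of holomorphic functions $F$ on the open unit disc with $\sup_{0\le R<1}\frac1{2\pi}\int_0^{2\pi}|F(Re^{it})|^r\,dt<\infty$, and let $H^r(\mathbb T)\subset L^r(\mathbb T)$ be the linear space of all boundary functions $f(e^{it})=\lim_{R\to1^-}F(Re^{it})$ (for a.e. $t$) of functions $F\in H^r(\mathbb D)$. Let $\alpha\in\mathbb R$ with $\alpha/2\pi$ irrational, and let $Tf(e^{it})=f(e^{i(t+\alpha)})$ be the operator on $L^r(\mathbb T)$ induced by the rotation by the angle $\alpha$. Denote by $\mathcal C$ the subspace of constant functions, and let closures be taken in $L^r(\mathbb T)$ with respect to the metric $d$. Then $$H^r(\mathbb T)=\mathcal C\oplus\overline{(I-T)H^r(\mathbb T)},$$ that is, $H^r(\mathbb T)=\mathcal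 C+\overline{(I-T)H^r(\mathbb T)}$ and $\mathcal C\cap\overline{(I-T)H^r(\mathbb T)}=\{0\}$. In particular the constant function $\mathbf 1$ does not belong to $\overline{(I-T)H^r(\mathbb T)}$, whereas $\mathbf 1\in\overline{(I-T)L^r(\mathbb T)}$ if $r<\frac13$. -/

import Mathlib

open MeasureTheory Filter Topology

noncomputable section

namespace HardyRotation

instance factTwoPiPos : Fact (0 < 2 * Real.pi) := ⟨Real.two_pi_pos⟩

/-- The circle `𝕋 = ℝ / 2πℤ`; its point `t` stands for `e^{it}` (`AddCircle.toCircle t`). -/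
abbrev Torus : Type := AddCircle (2 * Real.pi)

/-- Normalized Lebesgue measure `dt / 2π` on the circle. -/
abbrev mes : Measure Torus := AddCircle.haarAddCircle

/-- The complex space `L^r(𝕋)`, functions being identified when they agree almost everywhere. -/
abbrev Lr (r : ℝ) : Type := Lp ℂ (ENNReal.ofReal r) mes

/-- The metric `d(f,g) = ∫ |f - g|^r` of `L^r(𝕋)`, `0 < r < 1`. -/
def lrDist (r : ℝ) (f g : Lr r) : ℝ := ∫ t, ‖f t - g t‖ ^ r ∂mes

theorem integrable_norm_rpow {r : ℝ} (hr : 0 < r) (f : Lr r) :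
    Integrable (fun t => ‖f t‖ ^ r) mes := by
  have h := (Lp.memLp f).integrable_norm_rpow'
  rwa [ENNReal.toReal_ofReal hr.le] at h

theorem integrable_norm_sub_rpow {r : ℝ} (hr : 0 < r) (f g : Lr r) :
    Integrable (fun t => ‖f t - g t‖ ^ r) mes := by
  refine (integrable_norm_rpow hr (f - g)).congr ?_
  filter_upwards [Lp.coeFn_sub f g] with t ht
  rw [ht, Pi.sub_apply]

theorem norm_add_rpow_le {r : ℝ} (hr : 0 < r) (hr1 : r < 1) (a b : ℂ) :
    ‖a + b‖ ^ r ≤ ‖a‖ ^ r + ‖b‖ ^ r :=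
  (Real.rpow_le_rpow (norm_nonneg _) (norm_add_le a b) hr.le).trans
    (Real.rpow_add_le_add_rpow (norm_nonneg _) (norm_nonneg _) hr.le hr1.le)

theorem lrDist_add_le {r : ℝ} (hr : 0 < r) (hr1 : r < 1) (f₁ f₂ g₁ g₂ : Lr r) :
    lrDist r (f₁ + f₂) (g₁ + g₂) ≤ lrDist r f₁ g₁ + lrDist r f₂ g₂ := by
  unfold lrDist
  rw [← integral_add (integrable_norm_sub_rpow hr _ _) (integrable_norm_sub_rpow hr _ _)]
  refine integral_mono_ae (integrable_norm_sub_rpow hr _ _)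
    ((integrable_norm_sub_rpow hr _ _).add (integrable_norm_sub_rpow hr _ _)) ?_
  filter_upwards [Lp.coeFn_add f₁ f₂, Lp.coeFn_add g₁ g₂] with t h₁ h₂
  simp only [h₁, h₂, Pi.add_apply]
  rw [add_sub_add_comm]
  exact norm_add_rpow_le hr hr1 _ _

theorem lrDist_smul (r : ℝ) (c : ℂ) (f g : Lr r) :
    lrDist r (c • f) (c • g) = ‖c‖ ^ r * lrDist r f g := by
  unfold lrDist
  rw [← integral_const_mul]
  refine integral_congr_ae ?_
  filter_upwards [Lp.coeFn_smul c f, Lp.coeFn_smul c g] with t h₁ h₂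
  simp only [h₁, h₂, Pi.smul_apply]
  rw [← smul_sub, norm_smul, Real.mul_rpow (norm_nonneg _) (norm_nonneg _)]

/-- The closure of a linear subspace of `L^r(𝕋)` in the metric `lrDist r`. -/
def lrClosure {r : ℝ} (hr : 0 < r) (hr1 : r < 1) (W : Submodule ℂ (Lr r)) :
    Submodule ℂ (Lr r) where
  carrier := {f | ∀ ε > 0, ∃ g ∈ W, lrDist r f g < ε}
  zero_mem' := by
    intro ε hε
    refine ⟨0, W.zero_mem, ?_⟩
    have : lrDist r (0 : Lr r) 0 = 0 := by simp [lrDist, Real.zero_rpow hr.ne']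
    rwa [this]
  add_mem' := by
    intro f₁ f₂ h₁ h₂ ε hε
    obtain ⟨g₁, hg₁, d₁⟩ := h₁ (ε / 2) (half_pos hε)
    obtain ⟨g₂, hg₂, d₂⟩ := h₂ (ε / 2) (half_pos hε)
    exact ⟨g₁ + g₂, W.add_mem hg₁ hg₂,
      (lrDist_add_le hr hr1 f₁ f₂ g₁ g₂).trans_lt (by linarith)⟩
  smul_mem' := by
    intro c f h ε hε
    have hc : 0 ≤ ‖c‖ ^ r := Real.rpow_nonneg (norm_nonneg c) r
    obtain ⟨g, hg, d⟩ := h (ε / (‖c‖ ^ r + 1)) (by positivity)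
    refine ⟨c • g, W.smul_mem c hg, ?_⟩
    rw [lrDist_smul]
    rw [lt_div_iff₀ (by positivity)] at d
    have h0 : 0 ≤ lrDist r f g := integral_nonneg fun t => Real.rpow_nonneg (norm_nonneg _) r
    nlinarith

/-- The Hardy space `H^r(𝔻)` of the open unit disc: `f` is holomorphic in the disc and the means
`(1/2π) ∫₀^{2π} |f(R e^{it})|^r dt`, `0 ≤ R < 1`, are bounded. Only the values of `f` in the disc
matter. -/
def MemHardyDisc (r : ℝ) (f : ℂ → ℂ) : Prop :=
  DifferentiableOn ℂ f (Metric.ball 0 1) ∧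
    BddAbove ((fun R : ℝ => Real.circleAverage (fun z => ‖f z‖ ^ r) 0 R) '' Set.Ico 0 1)

theorem circleIntegrable_norm_rpow {r : ℝ} (hr : 0 < r) {f : ℂ → ℂ}
    (hf : DifferentiableOn ℂ f (Metric.ball 0 1)) {R : ℝ} (hR : R ∈ Set.Ico (0 : ℝ) 1) :
    CircleIntegrable (fun z => ‖f z‖ ^ r) 0 R := by
  refine ContinuousOn.circleIntegrable hR.1 ?_
  refine (hf.continuousOn.mono fun z hz => ?_).norm.rpow_const fun _ _ => Or.inr hr.le
  rw [mem_sphere_zero_iff_norm] at hz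
  rw [mem_ball_zero_iff, hz]
  exact hR.2

theorem MemHardyDisc.zero {r : ℝ} (hr : 0 < r) : MemHardyDisc r 0 := by
  refine ⟨differentiableOn_const 0, 0, ?_⟩
  rintro _ ⟨R, -, rfl⟩
  simp [Real.zero_rpow hr.ne', Real.circleAverage_const]

theorem MemHardyDisc.add {r : ℝ} (hr : 0 < r) (hr1 : r < 1) {f g : ℂ → ℂ}
    (hf : MemHardyDisc r f) (hg : MemHardyDisc r g) : MemHardyDisc r (f + g) := by
  obtain ⟨A, hA⟩ := hf.2
  obtain ⟨B, hB⟩ := hg.2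
  refine ⟨hf.1.add hg.1, A + B, ?_⟩
  rintro _ ⟨R, hR, rfl⟩
  have iF := circleIntegrable_norm_rpow hr hf.1 hR
  have iG := circleIntegrable_norm_rpow hr hg.1 hR
  have hle := Real.circleAverage_mono (circleIntegrable_norm_rpow hr (hf.1.add hg.1) hR)
    (iF.add iG) (fun z _ => norm_add_rpow_le hr hr1 (f z) (g z))
  have hsum := Real.circleAverage_add iF iG
  have h1 := hA ⟨R, hR, rfl⟩
  have h2 := hB ⟨R, hR, rfl⟩
  exact (hle.trans_eq hsum).trans (add_le_add h1 h2)

theorem MemHardyDisc.smul {r : ℝ} (c : ℂ) {f : ℂ → ℂ}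
    (hf : MemHardyDisc r f) : MemHardyDisc r (c • f) := by
  obtain ⟨A, hA⟩ := hf.2
  refine ⟨hf.1.const_smul c, ‖c‖ ^ r * A, ?_⟩
  rintro _ ⟨R, hR, rfl⟩
  have h : (fun z => ‖(c • f) z‖ ^ r) = fun z => (‖c‖ ^ r) • (‖f z‖ ^ r) := by
    funext z
    simp [Real.mul_rpow (norm_nonneg c) (norm_nonneg (f z))]
  simp only [h]
  rw [Real.circleAverage_fun_smul]
  exact mul_le_mul_of_nonneg_left (hA ⟨R, hR, rfl⟩) (Real.rpow_nonneg (norm_nonneg c) r)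

/-- `g` is the radial boundary function of `f`: for almost every `t`,
`f(R e^{it}) → g(t)` as `R → 1⁻`. -/
def IsRadialLimit (f : ℂ → ℂ) (g : Torus → ℂ) : Prop :=
  ∀ᵐ t ∂mes, Tendsto (fun R : ℝ => f ((R : ℂ) * (AddCircle.toCircle t : ℂ))) (𝓝[<] 1) (𝓝 (g t))

/-- `H^r(𝕋)`, the space of all radial boundary functions of members of `H^r(𝔻)`, as a linear
subspace of `L^r(𝕋)`. -/
def hardyCircle {r : ℝ} (hr : 0 < r) (hr1 : r < 1) : Submodule ℂ (Lr r) where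
  carrier := {g | ∃ f : ℂ → ℂ, MemHardyDisc r f ∧ IsRadialLimit f g}
  zero_mem' := by
    refine ⟨0, MemHardyDisc.zero hr, ?_⟩
    filter_upwards [Lp.coeFn_zero ℂ (ENNReal.ofReal r) mes] with t ht
    rw [ht]
    exact tendsto_const_nhds
  add_mem' := by
    rintro g₁ g₂ ⟨f₁, h₁, l₁⟩ ⟨f₂, h₂, l₂⟩
    refine ⟨f₁ + f₂, h₁.add hr hr1 h₂, ?_⟩
    filter_upwards [l₁, l₂, Lp.coeFn_add g₁ g₂] with t t₁ t₂ ht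
    rw [ht]
    exact t₁.add t₂
  smul_mem' := by
    rintro c g ⟨f, h, l⟩
    refine ⟨c • f, h.smul c, ?_⟩
    filter_upwards [l, Lp.coeFn_smul c g] with t tl ht
    rw [ht]
    exact tl.const_smul c

/-- The operator `(T f)(t) = f(t + α)` on `L^r(𝕋)` induced by the rotation `t ↦ t + α`, i.e.
`e^{it} ↦ e^{iα} e^{it}`. -/
def rotOp (r α : ℝ) : Lr r →ₗ[ℂ] Lr r :=
  Lp.compMeasurePreservingₗ ℂ (fun t : Torus => t + (α : Torus))
    (measurePreserving_add_right mes (α : Torus))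

/-- The subspace of constant functions. -/
def constants (r : ℝ) : Submodule ℂ (Lr r) :=
  LinearMap.range (Lp.constₗ (ENNReal.ofReal r) mes ℂ : ℂ →ₗ[ℂ] Lr r)

/-- The image `(I - T) W` of a subspace `W`, where `T` is the rotation operator. -/
def coboundaries (r α : ℝ) (W : Submodule ℂ (Lr r)) : Submodule ℂ (Lr r) :=
  W.map (LinearMap.id - rotOp r α)

end HardyRotation

end

/-!
For `F ∈ H^r(𝔻)` with boundary function `g`, the subharmonicity of `|F|^r` bounds `|F(w)|^r` by the
Poisson integral of `|g|^r` at `w`. At `w = 0` this makes `g ↦ F(0)` continuous on `H^r(𝕋)`; it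
vanishes on `(I - T) H^r(𝕋)`, hence on the closure, whose only constant is therefore `0`.

Conversely, the dilates of `F` converge to `g`, so `g - F(0)` is a limit of polynomials without
constant term, and a monomial `z ^ n` with `n ≥ 1` is an eigenvector of `I - T` with eigenvalue
`1 - e^{inα} ≠ 0`. That `H^r(𝕋)` is closed follows from the same bound, which makes the extensions
of a convergent sequence converge locally uniformly, and from Fatou's theorem for Poisson integrals.

Finally, let `n(t)` be the hitting time of a small open set `U`. Then `1 - (I - T) n` vanishes off
`U` and is the return time on `U`, whose integral is `1` by Kac's formula, so by Hölder's inequality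
`d(1, (I - T) n) ≤ |U|^{1 - r}`.
-/

noncomputable section

namespace HardyRotation

section Circle

/-- The point `e^{it}` of the complex plane. -/
abbrev unitPt (t : Torus) : ℂ := (AddCircle.toCircle t : ℂ)

theorem norm_unitPt (t : Torus) : ‖unitPt t‖ = 1 := Circle.norm_coe _

theorem continuous_unitPt : Continuous unitPt :=
  continuous_subtype_val.comp AddCircle.continuous_toCircle

theorem unitPt_add (s t : Torus) : unitPt (s + t) = unitPt s * unitPt t := by
  rw [unitPt, AddCircle.toCircle_add, Circle.coe_mul]

theorem unitPt_coe (x : ℝ) : unitPt (x : Torus) = Complex.exp (x * Complex.I) := by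
  rw [unitPt, AddCircle.toCircle_apply_mk, div_self Real.two_pi_pos.ne', one_mul, Circle.coe_exp]

theorem exists_unitPt_eq {z : ℂ} (hz : ‖z‖ = 1) : ∃ t, unitPt t = z := by
  refine ⟨(Complex.arg z : Torus), ?_⟩
  have h := Complex.norm_mul_exp_arg_mul_I z
  rwa [hz, Complex.ofReal_one, one_mul, ← unitPt_coe] at h

theorem circleAverage_eq_integral {E : Type*} [NormedAddCommGroup E] [NormedSpace ℝ E]
    (f : ℂ → E) (R : ℝ) :
    Real.circleAverage f 0 R = ∫ t, f (R * unitPt t) ∂mes := by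
  rw [AddCircle.integral_haarAddCircle,
    ← AddCircle.intervalIntegral_preimage (2 * Real.pi) 0, Real.circleAverage, zero_add]
  congr 1
  refine intervalIntegral.integral_congr fun x _ => ?_
  simp [circleMap, unitPt_coe]

theorem integrable_of_continuous {E : Type*} [NormedAddCommGroup E] {f : Torus → E}
    (hf : Continuous f) (μ : Measure Torus) [IsFiniteMeasure μ] : Integrable f μ :=
  hf.integrable_of_hasCompactSupport (HasCompactSupport.of_compactSpace f)

end Circle

section HarmonicMeasure

variable {w : ℂ}

theorem poissonKernel_unitPt (w : ℂ) (t : Torus) :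
    poissonKernel 0 w (unitPt t) = (1 - ‖w‖ ^ 2) / ‖unitPt t - w‖ ^ 2 := by
  rw [poissonKernel_def, sub_zero, sub_zero, norm_unitPt, one_pow]

theorem poissonKernel_unitPt_nonneg (hw : ‖w‖ ≤ 1) (t : Torus) :
    0 ≤ poissonKernel 0 w (unitPt t) := by
  rw [poissonKernel_unitPt]
  exact div_nonneg (sub_nonneg.mpr (pow_le_one₀ (norm_nonneg w) hw)) (sq_nonneg _)

theorem poissonKernel_unitPt_le (hw : ‖w‖ < 1) (t : Torus) :
    poissonKernel 0 w (unitPt t) ≤ (1 + ‖w‖) / (1 - ‖w‖) := by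
  have h := re_herglotzRieszKernel_le (mem_sphere_zero_iff_norm.mpr (norm_unitPt t))
    (mem_ball_zero_iff.mpr hw)
  simpa [poissonKernel_eq_re_herglotzRieszKernel, herglotzRieszKernel_def] using h

theorem continuous_poissonKernel_unitPt (hw : ‖w‖ < 1) :
    Continuous fun t => poissonKernel 0 w (unitPt t) := by
  simp only [poissonKernel_unitPt]
  refine continuous_const.div (by fun_prop) fun t => pow_ne_zero 2 (norm_ne_zero_iff.mpr ?_)
  rintro h
  exact hw.ne (sub_eq_zero.mp h ▸ norm_unitPt t)

/-- The harmonic measure of the unit disc seen from `w`, carried to the circle group: integrating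
against it is taking the Poisson integral at `w`. -/
def harmonicMeasure (w : ℂ) : Measure Torus :=
  mes.withDensity fun t => ENNReal.ofReal (poissonKernel 0 w (unitPt t))

theorem integral_harmonicMeasure {E : Type*} [NormedAddCommGroup E] [NormedSpace ℝ E]
    (hw : ‖w‖ < 1) (f : Torus → E) :
    ∫ t, f t ∂harmonicMeasure w = ∫ t, poissonKernel 0 w (unitPt t) • f t ∂mes := by
  rw [harmonicMeasure, integral_withDensity_eq_integral_toReal_smul
    (continuous_poissonKernel_unitPt hw).measurable.ennreal_ofReal (by simp)]
  simp only [ENNReal.toReal_ofReal (poissonKernel_unitPt_nonneg hw.le _)]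

theorem integral_harmonicMeasure_of_diffContOnCl {E : Type*} [NormedAddCommGroup E]
    [NormedSpace ℂ E] [CompleteSpace E] {f : ℂ → E} (hf : DiffContOnCl ℂ f (Metric.ball 0 1))
    (hw : ‖w‖ < 1) : ∫ t, f (unitPt t) ∂harmonicMeasure w = f w := by
  have h := hf.circleAverage_poissonKernel_smul (mem_ball_zero_iff.mpr hw)
  rw [circleAverage_eq_integral] at h
  simpa [integral_harmonicMeasure hw] using h

theorem isProbabilityMeasure_harmonicMeasure (hw : ‖w‖ < 1) :
    IsProbabilityMeasure (harmonicMeasure w) := by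
  have h : ∫ _, (1 : ℂ) ∂harmonicMeasure w = 1 :=
    integral_harmonicMeasure_of_diffContOnCl (f := fun _ => (1 : ℂ)) diffContOnCl_const hw
  rw [integral_const, Complex.real_smul, mul_one, Complex.ofReal_eq_one] at h
  exact ⟨(ENNReal.toReal_eq_one_iff _).mp h⟩

theorem harmonicMeasure_le (hw : ‖w‖ < 1) :
    harmonicMeasure w ≤ ENNReal.ofReal ((1 + ‖w‖) / (1 - ‖w‖)) • mes := by
  rw [← withDensity_const]
  exact withDensity_mono (Eventually.of_forall fun t =>
    ENNReal.ofReal_le_ofReal (poissonKernel_unitPt_le hw t))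

theorem harmonicMeasure_absolutelyContinuous (w : ℂ) : harmonicMeasure w ≪ mes :=
  withDensity_absolutelyContinuous _ _

theorem integrable_harmonicMeasure {E : Type*} [NormedAddCommGroup E] (hw : ‖w‖ < 1)
    {f : Torus → E} (hf : Integrable f mes) : Integrable f (harmonicMeasure w) :=
  hf.of_measure_le_smul ENNReal.ofReal_ne_top (harmonicMeasure_le hw)

theorem integral_harmonicMeasure_le (hw : ‖w‖ < 1) {h : Torus → ℝ} (hh : Integrable h mes)
    (h0 : ∀ t, 0 ≤ h t) :
    ∫ t, h t ∂harmonicMeasure w ≤ (1 + ‖w‖) / (1 - ‖w‖) * ∫ t, h t ∂mes := by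
  have hc : 0 ≤ (1 + ‖w‖) / (1 - ‖w‖) :=
    div_nonneg (by positivity) (sub_nonneg.mpr hw.le)
  refine (integral_mono_measure (harmonicMeasure_le hw) (Eventually.of_forall h0)
    (hh.smul_measure ENNReal.ofReal_ne_top)).trans_eq ?_
  rw [integral_smul_measure, ENNReal.toReal_ofReal hc, smul_eq_mul]

end HarmonicMeasure

section Subharmonicity

variable {w : ℂ} {F : ℂ → ℂ}

theorem exists_add_conj_of_mem_span_fourier {f : C(Torus, ℂ)}
    (hf : f ∈ Submodule.span ℂ (Set.range (@fourier (2 * Real.pi)))) :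
    ∃ q₁ q₂ : ℂ → ℂ, Differentiable ℂ q₁ ∧ Differentiable ℂ q₂ ∧
      ∀ t, f t = q₁ (unitPt t) + starRingEnd ℂ (q₂ (unitPt t)) := by
  induction hf using Submodule.span_induction with
  | mem x hx =>
    obtain ⟨n, rfl⟩ := hx
    obtain ⟨k, rfl | rfl⟩ := n.eq_nat_or_neg
    · refine ⟨fun z => z ^ k, fun _ => 0, by fun_prop, by fun_prop, fun t => ?_⟩
      simp [unitPt, AddCircle.toCircle_nsmul]
    · refine ⟨fun _ => 0, fun z => z ^ k, by fun_prop, by fun_prop, fun t => ?_⟩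
      rw [fourier_neg]
      simp [unitPt, AddCircle.toCircle_nsmul]
  | zero => exact ⟨fun _ => 0, fun _ => 0, by fun_prop, by fun_prop, fun t => by simp⟩
  | add x y _ _ hx hy =>
    obtain ⟨a, b, ha, hb, hab⟩ := hx
    obtain ⟨c, d, hc, hd, hcd⟩ := hy
    refine ⟨a + c, b + d, ha.add hc, hb.add hd, fun t => ?_⟩
    simp only [ContinuousMap.add_apply, hab, hcd, Pi.add_apply, map_add]
    ring
  | smul c x _ hx =>
    obtain ⟨a, b, ha, hb, hab⟩ := hx
    refine ⟨c • a, starRingEnd ℂ c • b, ha.const_smul _, hb.const_smul _, fun t => ?_⟩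
    simp [hab, mul_add]

theorem exists_differentiable_abs_sub_re_lt {u : Torus → ℝ} (hu : Continuous u) {δ : ℝ}
    (hδ : 0 < δ) : ∃ q : ℂ → ℂ, Differentiable ℂ q ∧ ∀ t, |u t - (q (unitPt t)).re| < δ := by
  let U : C(Torus, ℂ) := ⟨fun t => (u t : ℂ), Complex.continuous_ofReal.comp hu⟩
  have hU : U ∈ (Submodule.span ℂ (Set.range (@fourier (2 * Real.pi)))).topologicalClosure :=
    span_fourier_closure_eq_top (T := 2 * Real.pi) ▸ Submodule.mem_top
  obtain ⟨f, hf, hUf⟩ := Metric.mem_closure_iff.mp hU δ hδ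
  obtain ⟨q₁, q₂, hq₁, hq₂, hq⟩ := exists_add_conj_of_mem_span_fourier hf
  refine ⟨q₁ + q₂, hq₁.add hq₂, fun t => ?_⟩
  have hre : u t - ((q₁ + q₂) (unitPt t)).re = (U t - f t).re := by simp [hq t, U]
  calc |u t - ((q₁ + q₂) (unitPt t)).re| ≤ ‖U t - f t‖ := hre ▸ Complex.abs_re_le_norm _
    _ = dist (U t) (f t) := (dist_eq_norm _ _).symm
    _ ≤ dist U f := ContinuousMap.dist_apply_le_dist t
    _ < δ := hUf

theorem norm_le_exp_re_add {q : ℂ → ℂ} (hF : DiffContOnCl ℂ F (Metric.ball 0 1))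
    (hq : Differentiable ℂ q) {δ : ℝ}
    (hle : ∀ t, ‖F (unitPt t)‖ ≤ Real.exp ((q (unitPt t)).re + δ)) (hw : ‖w‖ ≤ 1) :
    ‖F w‖ ≤ Real.exp ((q w).re + δ) := by
  have hnorm : ∀ z, ‖Complex.exp (-q z) • F z‖ = Real.exp (-(q z).re) * ‖F z‖ := fun z => by
    rw [norm_smul, Complex.norm_exp, Complex.neg_re]
  have hG : DiffContOnCl ℂ (fun z => Complex.exp (-q z) • F z) (Metric.ball 0 1) :=
    hq.neg.cexp.diffContOnCl.smul hF
  have hmax : Real.exp (-(q w).re) * ‖F w‖ ≤ Real.exp δ := by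
    rw [← hnorm]
    refine Complex.norm_le_of_forall_mem_frontier_norm_le Metric.isBounded_ball hG (fun z hz => ?_)
      (closure_ball (0 : ℂ) one_ne_zero ▸ mem_closedBall_zero_iff.mpr hw)
    rw [frontier_ball (0 : ℂ) one_ne_zero, mem_sphere_zero_iff_norm] at hz
    obtain ⟨t, rfl⟩ := exists_unitPt_eq hz
    rw [hnorm, Real.exp_neg, inv_mul_le_iff₀ (Real.exp_pos _), ← Real.exp_add]
    exact hle t
  rwa [Real.exp_neg, inv_mul_le_iff₀ (Real.exp_pos _), ← Real.exp_add] at hmax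

theorem norm_le_exp_integral_harmonicMeasure (hF : DiffContOnCl ℂ F (Metric.ball 0 1))
    {u : Torus → ℝ} (hu : Continuous u) (hle : ∀ t, ‖F (unitPt t)‖ ≤ Real.exp (u t))
    (hw : ‖w‖ < 1) : ‖F w‖ ≤ Real.exp (∫ t, u t ∂harmonicMeasure w) := by
  have := isProbabilityMeasure_harmonicMeasure hw
  have key : ∀ δ > 0, ‖F w‖ ≤ Real.exp ((∫ t, u t ∂harmonicMeasure w) + δ + δ) := by
    intro δ hδ
    obtain ⟨q, hq, hqu⟩ := exists_differentiable_abs_sub_re_lt hu hδ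
    have hqc : Continuous fun t => q (unitPt t) := hq.continuous.comp continuous_unitPt
    have hre : (q w).re ≤ (∫ t, u t ∂harmonicMeasure w) + δ :=
      calc (q w).re = ∫ t, (q (unitPt t)).re ∂harmonicMeasure w := by
            rw [← integral_harmonicMeasure_of_diffContOnCl hq.diffContOnCl hw]
            exact (integral_re (integrable_of_continuous hqc _)).symm
        _ ≤ ∫ t, (u t + δ) ∂harmonicMeasure w :=
            integral_mono (integrable_of_continuous (Complex.continuous_re.comp hqc) _)
              (integrable_of_continuous (hu.add continuous_const) _)
              fun t => by linarith [(abs_lt.mp (hqu t)).1]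
        _ = (∫ t, u t ∂harmonicMeasure w) + δ := by
            rw [integral_add (integrable_of_continuous hu _) (integrable_const δ), integral_const,
              probReal_univ, one_smul]
    refine (norm_le_exp_re_add hF hq (δ := δ) (fun t => (hle t).trans ?_) hw.le).trans ?_
    · exact Real.exp_le_exp.mpr (by linarith [(abs_lt.mp (hqu t)).2])
    · gcongr
  have hlim : Tendsto (fun δ : ℝ => Real.exp ((∫ t, u t ∂harmonicMeasure w) + δ + δ)) (𝓝[>] 0)
      (𝓝 (Real.exp ((∫ t, u t ∂harmonicMeasure w) + 0 + 0))) :=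
    (Continuous.tendsto (by fun_prop) 0).mono_left nhdsWithin_le_nhds
  rw [add_zero, add_zero] at hlim
  exact ge_of_tendsto hlim (eventually_mem_nhdsWithin.mono key)

theorem norm_rpow_le_integral_harmonicMeasure (hF : DiffContOnCl ℂ F (Metric.ball 0 1)) {p : ℝ}
    (hp : 0 ≤ p) (hw : ‖w‖ < 1) :
    ‖F w‖ ^ p ≤ ∫ t, ‖F (unitPt t)‖ ^ p ∂harmonicMeasure w := by
  have := isProbabilityMeasure_harmonicMeasure hw
  have hFc : Continuous fun t => ‖F (unitPt t)‖ :=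
    (hF.continuousOn_ball.comp_continuous continuous_unitPt fun t => by simp [norm_unitPt]).norm
  have key : ∀ ε > 0, ‖F w‖ ^ p ≤ ∫ t, (‖F (unitPt t)‖ + ε) ^ p ∂harmonicMeasure w := by
    intro ε hε
    have hpos : ∀ t, 0 < ‖F (unitPt t)‖ + ε := fun t => by positivity
    have hexp : ∀ t, Real.exp (Real.log (‖F (unitPt t)‖ + ε) * p) = (‖F (unitPt t)‖ + ε) ^ p :=
      fun t => (Real.rpow_def_of_pos (hpos t) p).symm
    have hlog : Continuous fun t => Real.log (‖F (unitPt t)‖ + ε) :=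
      (hFc.add continuous_const).log fun t => (hpos t).ne'
    have hjensen := convexOn_exp.map_integral_le Real.continuous_exp.continuousOn isClosed_univ
      (Eventually.of_forall fun _ => Set.mem_univ _)
      (integrable_of_continuous (hlog.mul_const p) (harmonicMeasure w))
      (integrable_of_continuous (hlog.mul_const p).rexp _)
    simp only [hexp, integral_mul_const] at hjensen
    calc ‖F w‖ ^ p ≤ Real.exp (∫ t, Real.log (‖F (unitPt t)‖ + ε) ∂harmonicMeasure w) ^ p := by
          refine Real.rpow_le_rpow (norm_nonneg _)
            (norm_le_exp_integral_harmonicMeasure hF hlog (fun t => ?_) hw) hp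
          rw [Real.exp_log (hpos t)]
          exact le_add_of_nonneg_right hε.le
      _ ≤ ∫ t, (‖F (unitPt t)‖ + ε) ^ p ∂harmonicMeasure w := by rwa [← Real.exp_mul]
  have hcont : Continuous fun ε : ℝ => ∫ t, (‖F (unitPt t)‖ + ε) ^ p ∂harmonicMeasure w := by
    have := continuous_parametric_integral_of_continuous (μ := harmonicMeasure w)
      (f := fun (ε : ℝ) t => (‖F (unitPt t)‖ + ε) ^ p)
      (((hFc.comp continuous_snd).add continuous_fst).rpow_const fun _ => Or.inr hp)
      isCompact_univ
    simpa only [Measure.restrict_univ] using this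
  have hlim := (hcont.tendsto 0).mono_left (nhdsWithin_le_nhds (s := Set.Ioi 0))
  simp only [add_zero] at hlim
  exact ge_of_tendsto hlim (eventually_mem_nhdsWithin.mono key)

end Subharmonicity

section BoundaryDomination

/-- Bounded second moments make the family uniformly integrable. -/
theorem le_integral_of_tendsto_of_integral_sq_le {α ι : Type*} [MeasurableSpace α]
    {μ : Measure α} [IsFiniteMeasure μ] {l : Filter ι} [l.NeBot] [l.IsCountablyGenerated]
    {f : ι → α → ℝ} {g : α → ℝ} {a : ι → ℝ} {a₀ A : ℝ} (hf0 : ∀ i x, 0 ≤ f i x)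
    (hf : ∀ᶠ i in l, MemLp (f i) 2 μ) (hA : ∀ᶠ i in l, ∫ x, f i x ^ 2 ∂μ ≤ A)
    (hfg : ∀ᵐ x ∂μ, Tendsto (fun i => f i x) l (𝓝 (g x))) (hg : Integrable g μ)
    (ha : Tendsto a l (𝓝 a₀)) (haf : ∀ᶠ i in l, a i ≤ ∫ x, f i x ∂μ) : a₀ ≤ ∫ x, g x ∂μ := by
  have key : ∀ K > 0, a₀ ≤ ∫ x, g x ∂μ + A / K := by
    intro K hK
    have hmin : ∀ x : ℝ, x ≤ min x K + x ^ 2 / K := fun x => by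
      rcases le_total x K with h | h
      · rw [min_eq_left h]
        exact le_add_of_nonneg_right (by positivity)
      · have : x ≤ x ^ 2 / K := by rw [le_div_iff₀ hK]; nlinarith
        exact this.trans (le_add_of_nonneg_left (le_min (hK.le.trans h) hK.le))
    have htrunc : ∀ᶠ i in l, a i ≤ ∫ x, min (f i x) K ∂μ + A / K := by
      filter_upwards [hf, hA, haf] with i hi hAi hai
      have hi1 : Integrable (f i) μ := hi.integrable one_le_two
      have hiK : Integrable (fun x => min (f i x) K) μ := hi1.inf (integrable_const K)
      calc a i ≤ ∫ x, f i x ∂μ := hai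
        _ ≤ ∫ x, (min (f i x) K + f i x ^ 2 / K) ∂μ :=
            integral_mono hi1 (hiK.add (hi.integrable_sq.div_const K)) fun x => hmin (f i x)
        _ = ∫ x, min (f i x) K ∂μ + (∫ x, f i x ^ 2 ∂μ) / K := by
            rw [integral_add hiK (hi.integrable_sq.div_const K), integral_div]
        _ ≤ ∫ x, min (f i x) K ∂μ + A / K := by gcongr
    have hlim : Tendsto (fun i => ∫ x, min (f i x) K ∂μ) l (𝓝 (∫ x, min (g x) K ∂μ)) := by
      refine tendsto_integral_filter_of_dominated_convergence (fun _ => K)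
        (hf.mono fun i hi => hi.aestronglyMeasurable.inf aestronglyMeasurable_const)
        (Eventually.of_forall fun i => Eventually.of_forall fun x => ?_) (integrable_const K)
        (hfg.mono fun x hx => hx.min tendsto_const_nhds)
      rw [Real.norm_of_nonneg (le_min (hf0 i x) hK.le)]
      exact min_le_right _ _
    refine (le_of_tendsto_of_tendsto ha (hlim.add_const (A / K)) htrunc).trans ?_
    gcongr ?_ + _
    exact integral_mono (hg.inf (integrable_const K)) hg fun x => min_le_left _ _
  have hlim := (tendsto_const_nhds (x := A)).div_atTop tendsto_id |>.const_add (∫ x, g x ∂μ)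
  rw [add_zero] at hlim
  exact ge_of_tendsto hlim ((eventually_gt_atTop 0).mono key)

theorem eventually_mem_Ico_nhdsLT_one : ∀ᶠ R : ℝ in 𝓝[<] 1, R ∈ Set.Ico (0 : ℝ) 1 :=
  mem_of_superset (Ioo_mem_nhdsLT zero_lt_one) Set.Ioo_subset_Ico_self

theorem norm_ofReal_mul_lt_one {R : ℝ} (hR : R ∈ Set.Ico (0 : ℝ) 1) {z : ℂ} (hz : ‖z‖ ≤ 1) :
    ‖(R : ℂ) * z‖ < 1 := by
  rw [norm_mul, Complex.norm_real, Real.norm_of_nonneg hR.1]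
  exact (mul_le_of_le_one_right hR.1 hz).trans_lt hR.2

variable {F : ℂ → ℂ} {R r : ℝ} {w : ℂ}

theorem diffContOnCl_dilate (hF : DifferentiableOn ℂ F (Metric.ball 0 1))
    (hR : R ∈ Set.Ico (0 : ℝ) 1) : DiffContOnCl ℂ (fun z => F (R * z)) (Metric.ball 0 1) := by
  refine DifferentiableOn.diffContOnCl (hF.comp (by fun_prop) fun z hz => ?_)
  rw [closure_ball (0 : ℂ) one_ne_zero] at hz
  exact mem_ball_zero_iff.mpr (norm_ofReal_mul_lt_one hR (mem_closedBall_zero_iff.mp hz))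

theorem continuous_dilate (hF : DifferentiableOn ℂ F (Metric.ball 0 1))
    (hR : R ∈ Set.Ico (0 : ℝ) 1) : Continuous fun t => F (R * unitPt t) :=
  hF.continuousOn.comp_continuous (continuous_const.mul continuous_unitPt) fun t =>
    mem_ball_zero_iff.mpr (norm_ofReal_mul_lt_one hR (norm_unitPt t).le)

theorem tendsto_dilate (hF : DifferentiableOn ℂ F (Metric.ball 0 1)) (hw : ‖w‖ < 1) :
    Tendsto (fun R : ℝ => F (R * w)) (𝓝[<] 1) (𝓝 (F w)) := by
  have hc : ContinuousAt F ((1 : ℝ) * w) := by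
    rw [Complex.ofReal_one, one_mul]
    exact hF.continuousOn.continuousAt (Metric.isOpen_ball.mem_nhds (mem_ball_zero_iff.mpr hw))
  have h : ContinuousAt (fun R : ℝ => F (R * w)) 1 :=
    ContinuousAt.comp (f := fun R : ℝ => (R : ℂ) * w) hc (by fun_prop)
  simpa using h.tendsto.mono_left nhdsWithin_le_nhds

theorem MemHardyDisc.exists_integral_le (hF : MemHardyDisc r F) :
    ∃ A, ∀ R ∈ Set.Ico (0 : ℝ) 1, ∫ t, ‖F (R * unitPt t)‖ ^ r ∂mes ≤ A := by
  obtain ⟨A, hA⟩ := hF.2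
  refine ⟨A, fun R hR => ?_⟩
  rw [← circleAverage_eq_integral (fun z => ‖F z‖ ^ r) R]
  exact hA ⟨R, hR, rfl⟩

theorem rpow_half_sq {x : ℝ} (hx : 0 ≤ x) (r : ℝ) : (x ^ (r / 2)) ^ 2 = x ^ r := by
  rw [← Real.rpow_mul_natCast hx, Nat.cast_two, div_mul_cancel₀ r two_ne_zero]

/-- The exponent is halved because the means of `‖F‖ ^ (r / 2)`, having bounded second moments,
converge to those of the boundary function. -/
theorem MemHardyDisc.norm_rpow_half_le (hr : 0 ≤ r) (hF : MemHardyDisc r F) {g : Torus → ℂ}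
    (hg : Integrable (fun t => ‖g t‖ ^ (r / 2)) mes) (hFg : IsRadialLimit F g) (hw : ‖w‖ < 1) :
    ‖F w‖ ^ (r / 2) ≤ ∫ t, ‖g t‖ ^ (r / 2) ∂harmonicMeasure w := by
  have := isProbabilityMeasure_harmonicMeasure hw
  have hr2 : 0 ≤ r / 2 := by positivity
  obtain ⟨A, hA⟩ := hF.exists_integral_le
  have hcont : ∀ R ∈ Set.Ico (0 : ℝ) 1, ∀ p : ℝ, 0 ≤ p →
      Continuous fun t => ‖F (R * unitPt t)‖ ^ p := fun R hR p hp =>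
    (continuous_dilate hF.1 hR).norm.rpow_const fun _ => Or.inr hp
  refine le_integral_of_tendsto_of_integral_sq_le (l := 𝓝[<] (1 : ℝ))
    (f := fun R t => ‖F (R * unitPt t)‖ ^ (r / 2)) (a := fun R => ‖F (R * w)‖ ^ (r / 2))
    (A := (1 + ‖w‖) / (1 - ‖w‖) * A) (fun R t => by positivity) ?_ ?_ ?_
    (integrable_harmonicMeasure hw hg) ((tendsto_dilate hF.1 hw).norm.rpow_const (Or.inr hr2)) ?_
  · filter_upwards [eventually_mem_Ico_nhdsLT_one] with R hR
    exact (hcont R hR _ hr2).memLp_of_hasCompactSupport (HasCompactSupport.of_compactSpace _)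
  · filter_upwards [eventually_mem_Ico_nhdsLT_one] with R hR
    simp only [rpow_half_sq (norm_nonneg _)]
    refine (integral_harmonicMeasure_le hw (integrable_of_continuous (hcont R hR r hr) _)
      fun t => by positivity).trans ?_
    have : 0 < 1 - ‖w‖ := sub_pos.mpr hw
    gcongr
    exact hA R hR
  · filter_upwards [harmonicMeasure_absolutelyContinuous w hFg] with t ht
    exact ht.norm.rpow_const (Or.inr hr2)
  · filter_upwards [eventually_mem_Ico_nhdsLT_one] with R hR
    exact norm_rpow_le_integral_harmonicMeasure (diffContOnCl_dilate hF.1 hR) hr2 hw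

theorem MemHardyDisc.norm_rpow_le (hr : 0 ≤ r) (hF : MemHardyDisc r F) {g : Torus → ℂ}
    (hgm : AEStronglyMeasurable g mes) (hg : Integrable (fun t => ‖g t‖ ^ r) mes)
    (hFg : IsRadialLimit F g) (hw : ‖w‖ < 1) :
    ‖F w‖ ^ r ≤ ∫ t, ‖g t‖ ^ r ∂harmonicMeasure w := by
  have := isProbabilityMeasure_harmonicMeasure hw
  have hg2 : MemLp (fun t => ‖g t‖ ^ (r / 2)) 2 mes := by
    rw [memLp_two_iff_integrable_sq (hgm.norm.aemeasurable.pow_const _).aestronglyMeasurable]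
    simpa only [rpow_half_sq (norm_nonneg _)] using hg
  have hg1 : Integrable (fun t => ‖g t‖ ^ (r / 2)) mes := hg2.integrable one_le_two
  calc ‖F w‖ ^ r = (‖F w‖ ^ (r / 2)) ^ 2 := (rpow_half_sq (norm_nonneg _) r).symm
    _ ≤ (∫ t, ‖g t‖ ^ (r / 2) ∂harmonicMeasure w) ^ 2 := by
        gcongr
        exact hF.norm_rpow_half_le hr hg1 hFg hw
    _ ≤ ∫ t, (‖g t‖ ^ (r / 2)) ^ 2 ∂harmonicMeasure w :=
        (even_two.convexOn_pow (𝕜 := ℝ)).map_integral_le (continuous_pow 2).continuousOn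
          isClosed_univ (Eventually.of_forall fun _ => Set.mem_univ _)
          (integrable_harmonicMeasure hw hg1) (integrable_harmonicMeasure hw hg2.integrable_sq)
    _ = ∫ t, ‖g t‖ ^ r ∂harmonicMeasure w := by simp only [rpow_half_sq (norm_nonneg _)]

end BoundaryDomination

section Means

variable {F : ℂ → ℂ} {R r : ℝ}

theorem norm_ofReal_mul_unitPt (hR : 0 ≤ R) (t : Torus) : ‖(R : ℂ) * unitPt t‖ = R := by
  rw [norm_mul, norm_unitPt, mul_one, Complex.norm_real, Real.norm_of_nonneg hR]

theorem norm_sub_smul_comm {E : Type*} [NormedAddCommGroup E] [InnerProductSpace ℝ E] {a b : E}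
    (hab : ‖a‖ = ‖b‖) (R : ℝ) : ‖a - R • b‖ = ‖b - R • a‖ := by
  rw [← sq_eq_sq₀ (norm_nonneg _) (norm_nonneg _), norm_sub_sq_real, norm_sub_sq_real,
    norm_smul, norm_smul, inner_smul_right, inner_smul_right, real_inner_comm, hab]

theorem poissonKernel_ofReal_mul_comm (hR : 0 ≤ R) (s t : Torus) :
    poissonKernel 0 (R * unitPt s) (unitPt t) = poissonKernel 0 (R * unitPt t) (unitPt s) := by
  have h := norm_sub_smul_comm ((norm_unitPt t).trans (norm_unitPt s).symm) R
  rw [Complex.real_smul, Complex.real_smul] at h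
  rw [poissonKernel_unitPt, poissonKernel_unitPt, norm_ofReal_mul_unitPt hR,
    norm_ofReal_mul_unitPt hR, h]

theorem integrable_prod_poissonKernel_mul {h : Torus → ℝ} (hh : Integrable h mes)
    (hR : R ∈ Set.Ico (0 : ℝ) 1) :
    Integrable (fun x : Torus × Torus => poissonKernel 0 (R * unitPt x.1) (unitPt x.2) * h x.2)
      (mes.prod mes) := by
  have hlt : ∀ s, ‖(R : ℂ) * unitPt s‖ < 1 := fun s =>
    norm_ofReal_mul_lt_one hR (norm_unitPt s).le
  have hcont : Continuous fun x : Torus × Torus =>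
      poissonKernel 0 (R * unitPt x.1) (unitPt x.2) := by
    simp only [poissonKernel_unitPt, norm_ofReal_mul_unitPt hR.1]
    refine continuous_const.div ?_ fun x => pow_ne_zero 2 (norm_ne_zero_iff.mpr fun hx => ?_)
    · have := continuous_unitPt
      fun_prop
    · exact (hlt x.1).ne (sub_eq_zero.mp hx ▸ norm_unitPt x.2)
  refine (hh.comp_snd mes).bdd_mul (c := (1 + R) / (1 - R)) hcont.aestronglyMeasurable
    (Eventually.of_forall fun x => ?_)
  have h := poissonKernel_unitPt_le (hlt x.1) x.2
  rwa [norm_ofReal_mul_unitPt hR.1,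
    ← Real.norm_of_nonneg (poissonKernel_unitPt_nonneg (hlt x.1).le x.2)] at h

theorem integrable_integral_harmonicMeasure {h : Torus → ℝ} (hh : Integrable h mes)
    (hR : R ∈ Set.Ico (0 : ℝ) 1) :
    Integrable (fun s => ∫ t, h t ∂harmonicMeasure (R * unitPt s)) mes := by
  simp only [integral_harmonicMeasure (norm_ofReal_mul_lt_one hR (norm_unitPt _).le)]
  exact (integrable_prod_poissonKernel_mul hh hR).integral_prod_left

theorem integral_integral_harmonicMeasure {h : Torus → ℝ} (hh : Integrable h mes)
    (hR : R ∈ Set.Ico (0 : ℝ) 1) :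
    ∫ s, ∫ t, h t ∂harmonicMeasure (R * unitPt s) ∂mes = ∫ t, h t ∂mes := by
  have hlt : ∀ s, ‖(R : ℂ) * unitPt s‖ < 1 := fun s =>
    norm_ofReal_mul_lt_one hR (norm_unitPt s).le
  have hmass : ∀ t, ∫ s, poissonKernel 0 (R * unitPt t) (unitPt s) ∂mes = 1 := fun t => by
    have := isProbabilityMeasure_harmonicMeasure (hlt t)
    simpa using (integral_harmonicMeasure (hlt t) fun _ => (1 : ℝ)).symm
  simp only [integral_harmonicMeasure (hlt _), smul_eq_mul]
  rw [integral_integral_swap (integrable_prod_poissonKernel_mul hh hR)]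
  simp only [integral_mul_const, poissonKernel_ofReal_mul_comm hR.1 _, hmass, one_mul]

theorem integral_norm_rpow_dilate_le (hr : 0 ≤ r) (hF : DifferentiableOn ℂ F (Metric.ball 0 1))
    {h : Torus → ℝ} (hh : Integrable h mes)
    (hFh : ∀ w : ℂ, ‖w‖ < 1 → ‖F w‖ ^ r ≤ ∫ t, h t ∂harmonicMeasure w)
    (hR : R ∈ Set.Ico (0 : ℝ) 1) : ∫ t, ‖F (R * unitPt t)‖ ^ r ∂mes ≤ ∫ t, h t ∂mes := by
  rw [← integral_integral_harmonicMeasure hh hR]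
  exact integral_mono
    (integrable_of_continuous ((continuous_dilate hF hR).norm.rpow_const fun _ => Or.inr hr) _)
    (integrable_integral_harmonicMeasure hh hR)
    fun t => hFh _ (norm_ofReal_mul_lt_one hR (norm_unitPt t).le)

theorem memHardyDisc_of_le_integral_harmonicMeasure (hr : 0 ≤ r)
    (hF : DifferentiableOn ℂ F (Metric.ball 0 1)) {h : Torus → ℝ} (hh : Integrable h mes)
    (hFh : ∀ w : ℂ, ‖w‖ < 1 → ‖F w‖ ^ r ≤ ∫ t, h t ∂harmonicMeasure w) : MemHardyDisc r F := by
  refine ⟨hF, ∫ t, h t ∂mes, ?_⟩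
  rintro _ ⟨R, hR, rfl⟩
  exact (circleAverage_eq_integral _ R).trans_le (integral_norm_rpow_dilate_le hr hF hh hFh hR)

theorem norm_sub_rpow_le (hr : 0 < r) (hr1 : r < 1) (a b : ℂ) :
    ‖a - b‖ ^ r ≤ ‖a‖ ^ r + ‖b‖ ^ r := by
  simpa [sub_eq_add_neg] using norm_add_rpow_le hr hr1 a (-b)

theorem integrable_norm_sub_rpow_of_integrable {α : Type*} [MeasurableSpace α] {μ : Measure α}
    (hr : 0 < r) (hr1 : r < 1) {f g : α → ℂ} (hfm : AEStronglyMeasurable f μ)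
    (hgm : AEStronglyMeasurable g μ) (hf : Integrable (fun x => ‖f x‖ ^ r) μ)
    (hg : Integrable (fun x => ‖g x‖ ^ r) μ) : Integrable (fun x => ‖f x - g x‖ ^ r) μ := by
  refine (hf.add hg).mono' ((hfm.sub hgm).norm.aemeasurable.pow_const r).aestronglyMeasurable
    (Eventually.of_forall fun x => ?_)
  rw [Real.norm_of_nonneg (by positivity)]
  exact norm_sub_rpow_le hr hr1 _ _

/-- The Brezis-Lieb argument: `‖f‖ ^ r + ‖g‖ ^ r - ‖f - g‖ ^ r` lies between `0` and
`2 * ‖g‖ ^ r`, so dominated convergence applies to it. -/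
theorem tendsto_integral_norm_sub_rpow {α ι : Type*} [MeasurableSpace α] {μ : Measure α}
    {l : Filter ι} [l.IsCountablyGenerated] (hr : 0 < r) (hr1 : r < 1) {f : ι → α → ℂ} {g : α → ℂ}
    (hfm : ∀ᶠ i in l, AEStronglyMeasurable (f i) μ)
    (hf : ∀ᶠ i in l, Integrable (fun x => ‖f i x‖ ^ r) μ)
    (hgm : AEStronglyMeasurable g μ) (hg : Integrable (fun x => ‖g x‖ ^ r) μ)
    (hfg : ∀ᵐ x ∂μ, Tendsto (fun i => f i x) l (𝓝 (g x)))
    (hle : ∀ᶠ i in l, ∫ x, ‖f i x‖ ^ r ∂μ ≤ ∫ x, ‖g x‖ ^ r ∂μ) :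
    Tendsto (fun i => ∫ x, ‖f i x - g x‖ ^ r ∂μ) l (𝓝 0) := by
  have hsub : ∀ᶠ i in l, Integrable (fun x => ‖f i x - g x‖ ^ r) μ := by
    filter_upwards [hfm, hf] with i hmi hi
    exact integrable_norm_sub_rpow_of_integrable hr hr1 hmi hgm hi hg
  have hlim : Tendsto (fun i => ∫ x, (‖f i x‖ ^ r + ‖g x‖ ^ r - ‖f i x - g x‖ ^ r) ∂μ) l
      (𝓝 (∫ x, 2 * ‖g x‖ ^ r ∂μ)) := by
    refine tendsto_integral_filter_of_dominated_convergence (fun x => 2 * ‖g x‖ ^ r) ?_ ?_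
      (hg.const_mul 2) ?_
    · filter_upwards [hf, hsub] with i hi hsi
      exact ((hi.add hg).sub hsi).aestronglyMeasurable
    · refine Eventually.of_forall fun i => Eventually.of_forall fun x => ?_
      have h₁ := norm_sub_rpow_le hr hr1 (f i x) (g x)
      have h₂ := norm_add_rpow_le hr hr1 (f i x - g x) (g x)
      rw [sub_add_cancel] at h₂
      rw [Real.norm_of_nonneg (by linarith)]
      linarith
    · filter_upwards [hfg] with x hx
      have h₁ := hx.norm.rpow_const (p := r) (Or.inr hr.le)
      have h₂ := (hx.sub_const (g x)).norm.rpow_const (p := r) (Or.inr hr.le)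
      simpa [Real.zero_rpow hr.ne', two_mul] using (h₁.add_const (‖g x‖ ^ r)).sub h₂
  have hgap := hlim.const_sub (∫ x, 2 * ‖g x‖ ^ r ∂μ)
  rw [sub_self] at hgap
  refine squeeze_zero' (Eventually.of_forall fun i => integral_nonneg fun x => by positivity) ?_
    hgap
  filter_upwards [hf, hsub, hle] with i hi hsi hlei
  have hsplit : ∫ x, (‖f i x‖ ^ r + ‖g x‖ ^ r - ‖f i x - g x‖ ^ r) ∂μ =
      ∫ x, ‖f i x‖ ^ r ∂μ + ∫ x, ‖g x‖ ^ r ∂μ - ∫ x, ‖f i x - g x‖ ^ r ∂μ :=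
    (integral_sub (hi.add hg) hsi).trans (congrArg (· - _) (integral_add hi hg))
  rw [hsplit, integral_const_mul]
  linarith

theorem MemHardyDisc.tendsto_integral_dilate_sub (hr : 0 < r) (hr1 : r < 1)
    (hF : MemHardyDisc r F) {g : Torus → ℂ} (hgm : AEStronglyMeasurable g mes)
    (hg : Integrable (fun t => ‖g t‖ ^ r) mes) (hFg : IsRadialLimit F g) :
    Tendsto (fun R : ℝ => ∫ t, ‖F (R * unitPt t) - g t‖ ^ r ∂mes) (𝓝[<] 1) (𝓝 0) := by
  refine tendsto_integral_norm_sub_rpow hr hr1 ?_ ?_ hgm hg hFg ?_ <;>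
    filter_upwards [eventually_mem_Ico_nhdsLT_one] with R hR
  · exact (continuous_dilate hF.1 hR).aestronglyMeasurable
  · exact integrable_of_continuous
      ((continuous_dilate hF.1 hR).norm.rpow_const fun _ => Or.inr hr.le) _
  · exact integral_norm_rpow_dilate_le hr.le hF.1 hg
      (fun w hw => hF.norm_rpow_le hr.le hgm hg hFg hw) hR

end Means

section RadialLimits

variable {R : ℝ}

theorem two_div_pi_mul_norm_le (s : Torus) : 2 / Real.pi * ‖s‖ ≤ ‖unitPt s - 1‖ := by
  obtain ⟨y, hy, rfl⟩ : ∃ y : ℝ, |y| ≤ Real.pi ∧ (y : Torus) = s := by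
    refine ⟨Complex.arg (unitPt s), Complex.abs_arg_le_pi _, ?_⟩
    refine AddCircle.injective_toCircle Real.two_pi_pos.ne' (Subtype.ext ?_)
    have h := Complex.norm_mul_exp_arg_mul_I (unitPt s)
    rwa [norm_unitPt, Complex.ofReal_one, one_mul, ← unitPt_coe] at h
  have hnorm : ‖(y : Torus)‖ ≤ |y| := QuotientAddGroup.norm_mk_le_norm
  have hsin : 2 / Real.pi * |y / 2| ≤ |Real.sin (y / 2)| :=
    Real.mul_abs_le_abs_sin (by rw [abs_div, abs_two]; linarith)
  rw [unitPt_coe, mul_comm (y : ℂ), Complex.norm_exp_I_mul_ofReal_sub_one, Real.norm_eq_abs,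
    abs_mul, abs_two]
  calc 2 / Real.pi * ‖(y : Torus)‖ ≤ 2 / Real.pi * |y| := by gcongr
    _ = 2 * (2 / Real.pi * |y / 2|) := by rw [abs_div, abs_two]; ring
    _ ≤ 2 * |Real.sin (y / 2)| := by gcongr

theorem norm_sub_smul_sq {E : Type*} [NormedAddCommGroup E] [InnerProductSpace ℝ E] {a b : E}
    (ha : ‖a‖ = 1) (hb : ‖b‖ = 1) (R : ℝ) :
    ‖a - R • b‖ ^ 2 = (1 - R) ^ 2 + R * ‖a - b‖ ^ 2 := by
  rw [norm_sub_sq_real, norm_sub_sq_real, norm_smul, inner_smul_right, ha, hb, mul_one,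
    Real.norm_eq_abs, sq_abs]
  ring

theorem dist_sq_le_norm_unitPt_sub_sq (x t : Torus) :
    2 / 5 * dist x t ^ 2 ≤ ‖unitPt x - unitPt t‖ ^ 2 := by
  have hrot : ‖unitPt (x - t) - 1‖ = ‖unitPt x - unitPt t‖ := by
    rw [← mul_one ‖unitPt (x - t) - 1‖, ← norm_unitPt t, ← norm_mul, sub_mul, ← unitPt_add,
      sub_add_cancel, one_mul]
  have hpi : 2 / 5 ≤ (2 / Real.pi) ^ 2 := by
    rw [div_pow, div_le_div_iff₀ (by norm_num) (by positivity)]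
    nlinarith [Real.pi_lt_d2, Real.pi_pos]
  calc 2 / 5 * dist x t ^ 2 ≤ (2 / Real.pi * ‖x - t‖) ^ 2 := by
        rw [dist_eq_norm, mul_pow]; gcongr
    _ ≤ ‖unitPt (x - t) - 1‖ ^ 2 := by gcongr; exact two_div_pi_mul_norm_le _
    _ = ‖unitPt x - unitPt t‖ ^ 2 := by rw [hrot]

theorem poissonKernel_mul_le (hR : R ∈ Set.Ico (1 / 2 : ℝ) 1) (x t : Torus) :
    poissonKernel 0 (R * unitPt t) (unitPt x) * ((1 - R) ^ 2 + dist x t ^ 2) ≤ 10 * (1 - R) := by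
  have hR1 : 0 < 1 - R := sub_pos.mpr hR.2
  have hden : (1 - R) ^ 2 + dist x t ^ 2 ≤ 5 * ‖unitPt x - R * unitPt t‖ ^ 2 := by
    rw [← Complex.real_smul, norm_sub_smul_sq (norm_unitPt x) (norm_unitPt t)]
    nlinarith [dist_sq_le_norm_unitPt_sub_sq x t, hR.1, sq_nonneg ‖unitPt x - unitPt t‖]
  have hpos : 0 < ‖unitPt x - R * unitPt t‖ ^ 2 :=
    (mul_pos_iff_of_pos_left (by norm_num)).mp (lt_of_lt_of_le (by positivity) hden)
  rw [poissonKernel_unitPt, norm_ofReal_mul_unitPt (by linarith [hR.1]), div_mul_eq_mul_div,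
    div_le_iff₀ hpos]
  calc (1 - R ^ 2) * ((1 - R) ^ 2 + dist x t ^ 2)
      ≤ 2 * (1 - R) * (5 * ‖unitPt x - R * unitPt t‖ ^ 2) := by gcongr; nlinarith
    _ = 10 * (1 - R) * ‖unitPt x - R * unitPt t‖ ^ 2 := by ring

section LayerCake

variable {X : Type*} [PseudoMetricSpace X] [MeasurableSpace X] {ν : Measure X} [IsFiniteMeasure ν]
  {t : X} {A C ε : ℝ} {φ : X → ℝ}

theorem measureReal_superlevel_le (hC : 0 < C) (hε : 0 < ε)
    (hν : ∀ ρ > 0, ν.real (Metric.closedBall t ρ) ≤ A * ρ) (h0 : ∀ x, 0 ≤ φ x)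
    (hle : ∀ x, φ x * (ε ^ 2 + dist x t ^ 2) ≤ C * ε) {s : ℝ} (hs : 0 < s) :
    ν.real {x | s ≤ φ x} ≤ A * √(C * ε) * s ^ (-(1 / 2) : ℝ) := by
  have hsub : {x | s ≤ φ x} ⊆ Metric.closedBall t √(C * ε / s) := fun x hx => by
    refine Real.le_sqrt_of_sq_le ((le_div_iff₀ hs).mpr ?_)
    nlinarith [hle x, mul_le_mul_of_nonneg_right (Set.mem_ofPred.mp hx) (sq_nonneg (dist x t)),
      mul_nonneg (h0 x) (sq_nonneg ε)]
  refine (measureReal_mono hsub).trans ((hν _ (Real.sqrt_pos.mpr (by positivity))).trans_eq ?_)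
  rw [Real.rpow_neg hs.le, ← Real.sqrt_eq_rpow, Real.sqrt_div' _ hs.le, div_eq_mul_inv, mul_assoc]

theorem integral_le_of_measureReal_closedBall_le (hC : 0 < C) (hε : 0 < ε)
    (hν : ∀ ρ > 0, ν.real (Metric.closedBall t ρ) ≤ A * ρ) (hφ : AEStronglyMeasurable φ ν)
    (h0 : ∀ x, 0 ≤ φ x) (hle : ∀ x, φ x * (ε ^ 2 + dist x t ^ 2) ≤ C * ε) :
    ∫ x, φ x ∂ν ≤ 2 * C * A := by
  have hbdd : ∀ x, φ x ≤ C / ε := fun x => by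
    rw [le_div_iff₀ hε]
    nlinarith [hle x, mul_nonneg (h0 x) (sq_nonneg (dist x t))]
  have hint : Integrable φ ν := .of_bound hφ (C / ε) <| Eventually.of_forall fun x => by
    rw [Real.norm_of_nonneg (h0 x)]; exact hbdd x
  have hM : 0 ≤ C / ε := by positivity
  have hrpow : IntegrableOn (fun s : ℝ => A * √(C * ε) * s ^ (-(1 / 2) : ℝ))
      (Set.Ioc 0 (C / ε)) := by
    rw [← intervalIntegrable_iff_integrableOn_Ioc_of_le hM]
    exact (intervalIntegral.intervalIntegrable_rpow' (by norm_num)).const_mul _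
  calc ∫ x, φ x ∂ν = ∫ s in Set.Ioc 0 (C / ε), ν.real {x | s ≤ φ x} :=
        hint.integral_eq_integral_Ioc_meas_le (Eventually.of_forall h0) (Eventually.of_forall hbdd)
    _ ≤ ∫ s in Set.Ioc 0 (C / ε), A * √(C * ε) * s ^ (-(1 / 2) : ℝ) :=
        integral_mono_of_nonneg (Eventually.of_forall fun _ => measureReal_nonneg) hrpow
          ((ae_restrict_mem measurableSet_Ioc).mono fun _ hs =>
            measureReal_superlevel_le hC hε hν h0 hle hs.1)
    _ = 2 * (√(C * ε) * √(C / ε)) * A := by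
        rw [← intervalIntegral.integral_of_le hM, intervalIntegral.integral_const_mul,
          integral_rpow (Or.inl (by norm_num))]
        norm_num [← Real.sqrt_eq_rpow]
        ring
    _ = 2 * C * A := by
        rw [← Real.sqrt_mul (by positivity), mul_div_assoc', mul_assoc C, mul_comm ε,
          ← mul_assoc, mul_div_cancel_right₀ _ hε.ne', Real.sqrt_mul_self hC.le]

end LayerCake

theorem measureReal_closedBall_le (t : Torus) {ρ : ℝ} (hρ : 0 ≤ ρ) :
    mes.real (Metric.closedBall t ρ) ≤ ρ := by
  have hvol : (volume : Measure Torus).real (Metric.closedBall t ρ) ≤ 2 * ρ := by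
    rw [measureReal_def, AddCircle.volume_closedBall,
      ENNReal.toReal_ofReal (le_min Real.two_pi_pos.le (by linarith))]
    exact min_le_right _ _
  rw [AddCircle.volume_eq_smul_haarAddCircle, measureReal_ennreal_smul_apply,
    ENNReal.toReal_ofReal Real.two_pi_pos.le] at hvol
  nlinarith [Real.pi_gt_three, measureReal_nonneg (μ := mes) (s := Metric.closedBall t ρ)]

variable {E : Type*} [NormedAddCommGroup E] {h : Torus → E}

theorem ae_tendsto_average_norm_sub (hh : Integrable h mes) : ∀ᵐ t ∂mes,
    Tendsto (fun ρ => ⨍ x in Metric.closedBall t ρ, ‖h x - h t‖ ∂mes) (𝓝[>] 0) (𝓝 0) := by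
  have hvol : (volume : Measure Torus) = ENNReal.ofReal (2 * Real.pi) • mes :=
    AddCircle.volume_eq_smul_haarAddCircle
  have hpi : ENNReal.ofReal (2 * Real.pi) ≠ 0 := by simp [Real.pi_pos]
  have hint : Integrable h (volume : Measure Torus) :=
    hvol ▸ hh.smul_measure ENNReal.ofReal_ne_top
  have hac : mes ≪ (volume : Measure Torus) := hvol ▸ Measure.absolutelyContinuous_smul hpi
  filter_upwards [hac.ae_le (IsUnifLocDoublingMeasure.ae_tendsto_average_norm_sub volume
    hint.locallyIntegrable 1)] with t ht
  refine (ht (fun _ : ℝ => t) (fun ρ => ρ) tendsto_id <| eventually_mem_nhdsWithin.mono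
    fun ρ hρ => by rw [one_mul]; exact Metric.mem_closedBall_self (le_of_lt hρ)).congr fun ρ => ?_
  rw [setAverage_eq, setAverage_eq, hvol, Measure.restrict_smul, integral_smul_measure,
    measureReal_ennreal_smul_apply, mul_inv, ENNReal.toReal_ofReal Real.two_pi_pos.le, smul_smul,
    mul_right_comm, inv_mul_cancel₀ Real.two_pi_pos.ne', one_mul]

theorem ae_forall_setIntegral_norm_sub_le (hh : Integrable h mes) : ∀ᵐ t ∂mes, ∀ η > 0, ∃ δ > 0,
    ∀ ρ ∈ Set.Ioc 0 δ, ∫ x in Metric.closedBall t ρ, ‖h x - h t‖ ∂mes ≤ η * ρ := by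
  filter_upwards [ae_tendsto_average_norm_sub hh] with t ht η hη
  obtain ⟨δ, hδ, hsub⟩ := mem_nhdsGT_iff_exists_Ioc_subset.mp (ht.eventually_lt_const hη)
  refine ⟨δ, hδ, fun ρ hρ => ?_⟩
  have havg : ⨍ x in Metric.closedBall t ρ, ‖h x - h t‖ ∂mes < η := hsub hρ
  rw [← measure_smul_setAverage _ (measure_ne_top _ _), smul_eq_mul, mul_comm η]
  exact mul_le_mul (measureReal_closedBall_le t hρ.1.le) havg.le
    (integral_nonneg fun _ => norm_nonneg _) hρ.1.le

theorem setIntegral_poissonKernel_mul_le {φ : Torus → ℝ} (hφ : Integrable φ mes)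
    (h0 : ∀ x, 0 ≤ φ x) {t : Torus} {δ η : ℝ} (hδ : 0 < δ)
    (hball : ∀ ρ ∈ Set.Ioc 0 δ, ∫ x in Metric.closedBall t ρ, φ x ∂mes ≤ η * ρ)
    (hR : R ∈ Set.Ico (1 / 2 : ℝ) 1) :
    ∫ x in Metric.closedBall t δ, poissonKernel 0 (R * unitPt t) (unitPt x) * φ x ∂mes ≤
      20 * η := by
  set B := Metric.closedBall t δ
  have hw : ‖(R : ℂ) * unitPt t‖ < 1 :=
    norm_ofReal_mul_lt_one ⟨by linarith [hR.1], hR.2⟩ (norm_unitPt t).le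
  have hη : 0 ≤ η := nonneg_of_mul_nonneg_left
    ((integral_nonneg h0).trans (hball δ ⟨hδ, le_rfl⟩)) hδ
  set ν := (mes.restrict B).withDensity fun x => ENNReal.ofReal (φ x)
  have hfin : IsFiniteMeasure ν := isFiniteMeasure_withDensity_ofReal hφ.restrict.2
  have hν : ∀ ρ > 0, ν.real (Metric.closedBall t ρ) ≤ η * ρ := fun ρ hρ => by
    have hmin : Metric.closedBall t ρ ∩ B = Metric.closedBall t (min ρ δ) := by
      ext x; simp [B]
    have hmass : ν.real (Metric.closedBall t ρ) =
        ∫ x in Metric.closedBall t (min ρ δ), φ x ∂mes := by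
      rw [measureReal_def, withDensity_apply _ Metric.isClosed_closedBall.measurableSet,
        Measure.restrict_restrict Metric.isClosed_closedBall.measurableSet, hmin,
        integral_eq_lintegral_of_nonneg_ae (Eventually.of_forall h0) hφ.restrict.1]
    rw [hmass]
    exact (hball _ ⟨lt_min hρ hδ, min_le_right _ _⟩).trans (by gcongr; exact min_le_left _ _)
  have hmain := integral_le_of_measureReal_closedBall_le (by norm_num) (sub_pos.mpr hR.2) hν
    (continuous_poissonKernel_unitPt hw).aestronglyMeasurable
    (poissonKernel_unitPt_nonneg hw.le) fun x => poissonKernel_mul_le hR x t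
  rw [integral_withDensity_eq_integral_toReal_smul₀ hφ.restrict.1.aemeasurable.ennreal_ofReal
    (by simp)] at hmain
  simp only [ENNReal.toReal_ofReal (h0 _), smul_eq_mul, mul_comm (φ _)] at hmain
  linarith

theorem integral_harmonicMeasure_le_of_closedBall {φ : Torus → ℝ} (hφ : Integrable φ mes)
    (h0 : ∀ x, 0 ≤ φ x) {t : Torus} {δ η : ℝ} (hδ : 0 < δ)
    (hball : ∀ ρ ∈ Set.Ioc 0 δ, ∫ x in Metric.closedBall t ρ, φ x ∂mes ≤ η * ρ)
    (hR : R ∈ Set.Ico (1 / 2 : ℝ) 1) :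
    ∫ x, φ x ∂harmonicMeasure (R * unitPt t) ≤
      20 * η + 10 * (1 - R) / δ ^ 2 * ∫ x, φ x ∂mes := by
  have hw : ‖(R : ℂ) * unitPt t‖ < 1 :=
    norm_ofReal_mul_lt_one ⟨by linarith [hR.1], hR.2⟩ (norm_unitPt t).le
  have hint : Integrable (fun x => poissonKernel 0 (R * unitPt t) (unitPt x) * φ x) mes :=
    hφ.bdd_mul (continuous_poissonKernel_unitPt hw).aestronglyMeasurable
      (Eventually.of_forall fun x => by
        rw [Real.norm_of_nonneg (poissonKernel_unitPt_nonneg hw.le x)]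
        exact poissonKernel_unitPt_le hw x)
  have hfar : ∫ x in (Metric.closedBall t δ)ᶜ,
      poissonKernel 0 (R * unitPt t) (unitPt x) * φ x ∂mes ≤
        10 * (1 - R) / δ ^ 2 * ∫ x, φ x ∂mes := by
    rw [← integral_const_mul]
    have hR1 : 0 < 1 - R := sub_pos.mpr hR.2
    have hcφ : 0 ≤ fun x => 10 * (1 - R) / δ ^ 2 * φ x := fun x =>
      mul_nonneg (by positivity) (h0 x)
    refine (setIntegral_mono_on hint.integrableOn (hφ.const_mul _).integrableOn
      Metric.isClosed_closedBall.measurableSet.compl fun x hx => ?_).trans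
        (setIntegral_le_integral (hφ.const_mul _) (Eventually.of_forall hcφ))
    refine mul_le_mul_of_nonneg_right ((le_div_iff₀ (by positivity)).mpr ?_) (h0 x)
    have hx' : δ < dist x t := by simpa using hx
    refine le_trans ?_ (poissonKernel_mul_le hR x t)
    refine mul_le_mul_of_nonneg_left ?_ (poissonKernel_unitPt_nonneg hw.le x)
    nlinarith [sq_nonneg (1 - R)]
  rw [integral_harmonicMeasure hw]
  simp only [smul_eq_mul]
  rw [← integral_add_compl Metric.isClosed_closedBall.measurableSet hint]
  exact add_le_add (setIntegral_poissonKernel_mul_le hφ h0 hδ hball hR) hfar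

theorem ae_tendsto_integral_harmonicMeasure [NormedSpace ℝ E] [CompleteSpace E]
    (hh : Integrable h mes) : ∀ᵐ t ∂mes,
    Tendsto (fun R : ℝ => ∫ x, h x ∂harmonicMeasure (R * unitPt t)) (𝓝[<] 1) (𝓝 (h t)) := by
  filter_upwards [ae_forall_setIntegral_norm_sub_le hh] with t ht
  rw [tendsto_iff_norm_sub_tendsto_zero, Metric.tendsto_nhds]
  intro η hη
  obtain ⟨δ, hδ, hball⟩ := ht (η / 40) (by positivity)
  have hφ : Integrable (fun x => ‖h x - h t‖) mes := (hh.sub (integrable_const _)).norm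
  have hfar : Tendsto (fun R : ℝ => 10 * (1 - R) / δ ^ 2 * ∫ x, ‖h x - h t‖ ∂mes) (𝓝[<] 1)
      (𝓝 0) := by
    refine (Continuous.tendsto' (by fun_prop) 1 0 ?_).mono_left nhdsWithin_le_nhds
    rw [sub_self, mul_zero, zero_div, zero_mul]
  filter_upwards [hfar.eventually_lt_const (half_pos hη),
    Ico_mem_nhdsLT (show (1 / 2 : ℝ) < 1 by norm_num)] with R hlt hR
  have hw : ‖(R : ℂ) * unitPt t‖ < 1 :=
    norm_ofReal_mul_lt_one ⟨by linarith [hR.1], hR.2⟩ (norm_unitPt t).le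
  have := isProbabilityMeasure_harmonicMeasure hw
  have hdiff : ∫ x, h x ∂harmonicMeasure (R * unitPt t) - h t =
      ∫ x, (h x - h t) ∂harmonicMeasure (R * unitPt t) := by
    rw [integral_sub (integrable_harmonicMeasure hw hh) (integrable_const _), integral_const,
      probReal_univ, one_smul]
  rw [dist_zero_right, norm_norm, hdiff]
  calc ‖∫ x, (h x - h t) ∂harmonicMeasure (R * unitPt t)‖
      ≤ ∫ x, ‖h x - h t‖ ∂harmonicMeasure (R * unitPt t) := norm_integral_le_integral_norm _
    _ ≤ 20 * (η / 40) + 10 * (1 - R) / δ ^ 2 * ∫ x, ‖h x - h t‖ ∂mes :=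
        integral_harmonicMeasure_le_of_closedBall hφ (fun _ => norm_nonneg _) hδ hball hR
    _ < η := by linarith

end RadialLimits

section Metric

variable {r : ℝ}

theorem lrDist_congr {f g : Lr r} {φ ψ : Torus → ℂ} (hf : f =ᵐ[mes] φ) (hg : g =ᵐ[mes] ψ) :
    lrDist r f g = ∫ t, ‖φ t - ψ t‖ ^ r ∂mes :=
  integral_congr_ae (by filter_upwards [hf, hg] with t h₁ h₂; rw [h₁, h₂])

theorem lrDist_nonneg (f g : Lr r) : 0 ≤ lrDist r f g := integral_nonneg fun _ => by positivity

theorem lrDist_triangle (hr : 0 < r) (hr1 : r < 1) (f g h : Lr r) :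
    lrDist r f h ≤ lrDist r f g + lrDist r g h := by
  unfold lrDist
  rw [← integral_add (integrable_norm_sub_rpow hr f g) (integrable_norm_sub_rpow hr g h)]
  refine integral_mono (integrable_norm_sub_rpow hr f h)
    ((integrable_norm_sub_rpow hr f g).add (integrable_norm_sub_rpow hr g h)) fun t => ?_
  have h := norm_add_rpow_le hr hr1 (f t - g t) (g t - h t)
  rwa [sub_add_sub_cancel] at h

theorem lrDist_comm (f g : Lr r) : lrDist r f g = lrDist r g f := by
  simp only [lrDist, norm_sub_rev]

theorem lrDist_const (c d : ℂ) :
    lrDist r (Lp.const (ENNReal.ofReal r) mes c) (Lp.const (ENNReal.ofReal r) mes d) =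
      ‖c - d‖ ^ r := by
  rw [lrDist_congr (Lp.coeFn_const _ _ c) (Lp.coeFn_const _ _ d)]
  simp

theorem lrDist_sub_le (hr : 0 < r) (hr1 : r < 1) (f₁ f₂ g₁ g₂ : Lr r) :
    lrDist r (f₁ - f₂) (g₁ - g₂) ≤ lrDist r f₁ g₁ + lrDist r f₂ g₂ := by
  have h := lrDist_smul r (-1) f₂ g₂
  rw [norm_neg, norm_one, Real.one_rpow, one_mul, neg_one_smul, neg_one_smul] at h
  rw [sub_eq_add_neg, sub_eq_add_neg, ← h]
  exact lrDist_add_le hr hr1 _ _ _ _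

end Metric

section HardyExtension

/-- `F` is a function of `H^r(𝔻)` with radial boundary function `g`, so that
`g ∈ H^r(𝕋)` means that `g` has such an extension into the disc. -/
def IsHardyExtension (r : ℝ) (F : ℂ → ℂ) (g : Torus → ℂ) : Prop :=
  MemHardyDisc r F ∧ IsRadialLimit F g

namespace IsHardyExtension

variable {r : ℝ} {F G : ℂ → ℂ} {w : ℂ}

theorem congr {f g : Torus → ℂ} (hF : IsHardyExtension r F f) (hfg : f =ᵐ[mes] g) :
    IsHardyExtension r F g := by
  refine ⟨hF.1, ?_⟩
  filter_upwards [hF.2, hfg] with t ht h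
  rwa [← h]

theorem sub (hr : 0 < r) (hr1 : r < 1) {f g : Torus → ℂ} (hF : IsHardyExtension r F f)
    (hG : IsHardyExtension r G g) : IsHardyExtension r (F - G) (f - g) := by
  have hFG : F - G = F + (-1 : ℂ) • G := by rw [neg_one_smul, sub_eq_add_neg]
  refine ⟨hFG ▸ hF.1.add hr hr1 (hG.1.smul (-1)), ?_⟩
  filter_upwards [hF.2, hG.2] with t hf hg using hf.sub hg

theorem rotate {g : Torus → ℂ} (hF : IsHardyExtension r F g) (a : Torus) :
    IsHardyExtension r (fun z => F (unitPt a * z)) fun t => g (t + a) := by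
  have hcomm : ∀ (R : ℝ) (t : Torus), unitPt a * (R * unitPt t) = R * unitPt (t + a) :=
    fun R t => by rw [unitPt_add]; ring
  obtain ⟨A, hA⟩ := hF.1.exists_integral_le
  refine ⟨⟨hF.1.1.comp (by fun_prop) fun z hz => ?_, A, ?_⟩, ?_⟩
  · rw [mem_ball_zero_iff] at hz ⊢
    rwa [norm_mul, norm_unitPt, one_mul]
  · rintro _ ⟨R, hR, rfl⟩
    refine le_of_eq_of_le ?_ (hA R hR)
    simp only [circleAverage_eq_integral, hcomm]
    exact integral_add_right_eq_self (fun t => ‖F (R * unitPt t)‖ ^ r) a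
  · filter_upwards [(measurePreserving_add_right mes a).quasiMeasurePreserving.ae hF.2] with t ht
    exact ht.congr fun R => congrArg F (hcomm R t).symm

theorem of_differentiable (hr : 0 ≤ r) (hF : Differentiable ℂ F) :
    IsHardyExtension r F fun t => F (unitPt t) := by
  have hcont : Continuous fun t => ‖F (unitPt t)‖ ^ r :=
    (hF.continuous.comp continuous_unitPt).norm.rpow_const fun _ => Or.inr hr
  refine ⟨memHardyDisc_of_le_integral_harmonicMeasure hr hF.differentiableOn
    (integrable_of_continuous hcont _) fun w hw =>
      norm_rpow_le_integral_harmonicMeasure hF.diffContOnCl hr hw, Eventually.of_forall fun t => ?_⟩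
  have hcont : Continuous fun R : ℝ => F (R * unitPt t) := hF.continuous.comp (by fun_prop)
  exact (hcont.tendsto' 1 _ (by rw [Complex.ofReal_one, one_mul])).mono_left nhdsWithin_le_nhds

theorem norm_sub_rpow_le_integral (hr : 0 < r) (hr1 : r < 1) {f g : Lr r}
    (hF : IsHardyExtension r F f) (hG : IsHardyExtension r G g) (hw : ‖w‖ < 1) :
    ‖F w - G w‖ ^ r ≤ ∫ t, ‖f t - g t‖ ^ r ∂harmonicMeasure w := by
  have h := hF.sub hr hr1 hG
  exact h.1.norm_rpow_le hr.le ((Lp.aestronglyMeasurable f).sub (Lp.aestronglyMeasurable g))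
    (integrable_norm_sub_rpow hr f g) h.2 hw

theorem norm_sub_rpow_le_lrDist (hr : 0 < r) (hr1 : r < 1) {f g : Lr r}
    (hF : IsHardyExtension r F f) (hG : IsHardyExtension r G g) (hw : ‖w‖ < 1) :
    ‖F w - G w‖ ^ r ≤ (1 + ‖w‖) / (1 - ‖w‖) * lrDist r f g :=
  (hF.norm_sub_rpow_le_integral hr hr1 hG hw).trans
    (integral_harmonicMeasure_le hw (integrable_norm_sub_rpow hr f g) fun _ => by positivity)

theorem norm_zero_sub_rpow_le_lrDist (hr : 0 < r) (hr1 : r < 1) {f g : Lr r}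
    (hF : IsHardyExtension r F f) (hG : IsHardyExtension r G g) :
    ‖F 0 - G 0‖ ^ r ≤ lrDist r f g := by
  simpa using hF.norm_sub_rpow_le_lrDist hr hr1 hG (w := 0) (by simp)

end IsHardyExtension

variable {r : ℝ} {F : ℂ → ℂ}

theorem coeFn_rotOp (r α : ℝ) (f : Lr r) :
    rotOp r α f =ᵐ[mes] fun t => f (t + (α : Torus)) :=
  Lp.coeFn_compMeasurePreserving f (measurePreserving_add_right mes (α : Torus))

theorem isHardyExtension_const (hr : 0 ≤ r) (c : ℂ) :
    IsHardyExtension r (fun _ => c) (Lp.const (ENNReal.ofReal r) mes c) :=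
  (IsHardyExtension.of_differentiable hr (differentiable_const c)).congr
    (Lp.coeFn_const _ _ c).symm

theorem constants_le_hardyCircle (hr : 0 < r) (hr1 : r < 1) :
    constants r ≤ hardyCircle hr hr1 := by
  rintro _ ⟨c, rfl⟩
  exact ⟨_, isHardyExtension_const hr.le c⟩

theorem exists_isHardyExtension_of_mem_coboundaries (hr : 0 < r) (hr1 : r < 1) {α : ℝ} {f : Lr r}
    (hf : f ∈ coboundaries r α (hardyCircle hr hr1)) :
    ∃ F, IsHardyExtension r F f ∧ F 0 = 0 := by
  obtain ⟨g, ⟨G, hG⟩, rfl⟩ := hf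
  have hG : IsHardyExtension r G g := hG
  refine ⟨G - fun z => G (unitPt (α : Torus) * z), (hG.sub hr hr1 (hG.rotate α)).congr ?_, ?_⟩
  · filter_upwards [coeFn_rotOp r α g, Lp.coeFn_sub g (rotOp r α g)] with t hrot hsub
    exact (hsub.trans (congrArg (g t - ·) hrot)).symm
  · simp

theorem coboundaries_le_hardyCircle (hr : 0 < r) (hr1 : r < 1) (α : ℝ) :
    coboundaries r α (hardyCircle hr hr1) ≤ hardyCircle hr hr1 := fun _ hf =>
  (exists_isHardyExtension_of_mem_coboundaries hr hr1 hf).imp fun _ h => h.1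

theorem eq_zero_of_const_mem_lrClosure_coboundaries (hr : 0 < r) (hr1 : r < 1) {α : ℝ} {c : ℂ}
    (hc : Lp.const (ENNReal.ofReal r) mes c ∈
      lrClosure hr hr1 (coboundaries r α (hardyCircle hr hr1))) : c = 0 := by
  by_contra hne
  obtain ⟨f, hf, hlt⟩ := hc _ (Real.rpow_pos_of_pos (norm_pos_iff.mpr hne) r)
  obtain ⟨F, hF, hF0⟩ := exists_isHardyExtension_of_mem_coboundaries hr hr1 hf
  have hle := (isHardyExtension_const hr.le c).norm_zero_sub_rpow_le_lrDist hr hr1 hF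
  rw [hF0, sub_zero] at hle
  exact hlt.not_ge hle

end HardyExtension

section Polynomials

variable {r : ℝ} {F : ℂ → ℂ}

theorem memLp_polynomial (r : ℝ) (p : Polynomial ℂ) :
    MemLp (fun t => p.eval (unitPt t)) (ENNReal.ofReal r) mes :=
  (p.continuous.comp continuous_unitPt).memLp_of_hasCompactSupport
    (HasCompactSupport.of_compactSpace _)

/-- The restrictions of polynomials to the circle, as elements of `L^r(𝕋)`. -/
def polyLr (r : ℝ) : Polynomial ℂ →ₗ[ℂ] Lr r where
  toFun p := (memLp_polynomial r p).toLp _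
  map_add' p q := by
    rw [← MemLp.toLp_add]
    exact MemLp.toLp_congr _ _ (Eventually.of_forall fun t => Polynomial.eval_add)
  map_smul' c p := by
    rw [RingHom.id_apply, ← MemLp.toLp_const_smul]
    exact MemLp.toLp_congr _ _ (Eventually.of_forall fun t => Polynomial.eval_smul _ _ _)

theorem coeFn_polyLr (r : ℝ) (p : Polynomial ℂ) :
    polyLr r p =ᵐ[mes] fun t => p.eval (unitPt t) :=
  MemLp.coeFn_toLp (memLp_polynomial r p)

theorem isHardyExtension_polyLr (hr : 0 ≤ r) (p : Polynomial ℂ) :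
    IsHardyExtension r (fun z => p.eval z) (polyLr r p) :=
  (IsHardyExtension.of_differentiable hr p.differentiable).congr (coeFn_polyLr r p).symm

theorem polyLr_C (r : ℝ) (c : ℂ) :
    polyLr r (Polynomial.C c) = Lp.const (ENNReal.ofReal r) mes c := by
  refine Lp.ext ((coeFn_polyLr r _).trans ((Lp.coeFn_const _ _ c).trans ?_).symm)
  exact Eventually.of_forall fun t => Polynomial.eval_C.symm

theorem rotOp_polyLr_monomial (r α : ℝ) (n : ℕ) (c : ℂ) :
    rotOp r α (polyLr r (Polynomial.monomial n c)) =
      unitPt (α : Torus) ^ n • polyLr r (Polynomial.monomial n c) := by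
  rw [← map_smul]
  refine Lp.ext ((coeFn_rotOp r α _).trans (.trans ?_ (coeFn_polyLr r _).symm))
  filter_upwards [(measurePreserving_add_right mes (α : Torus)).quasiMeasurePreserving.ae
    (coeFn_polyLr r (Polynomial.monomial n c))] with t ht
  rw [ht, unitPt_add, Polynomial.eval_monomial, Polynomial.eval_smul, Polynomial.eval_monomial,
    smul_eq_mul]
  ring

theorem unitPt_pow_ne_one {a : Torus} (ha : ¬IsOfFinAddOrder a) {n : ℕ} (hn : n ≠ 0) :
    unitPt a ^ n ≠ 1 := fun h => by
  refine ha (isOfFinAddOrder_iff_nsmul_eq_zero.mpr ⟨n, hn.pos, ?_⟩)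
  refine AddCircle.injective_toCircle Real.two_pi_pos.ne' (Subtype.ext ?_)
  rw [AddCircle.toCircle_nsmul, AddCircle.toCircle_zero]
  exact_mod_cast h

theorem polyLr_sub_const_mem_coboundaries (hr : 0 < r) (hr1 : r < 1) {α : ℝ}
    (hα : ¬IsOfFinAddOrder (α : Torus)) (p : Polynomial ℂ) :
    polyLr r p - Lp.const (ENNReal.ofReal r) mes (p.eval 0) ∈
      coboundaries r α (hardyCircle hr hr1) := by
  induction p using Polynomial.induction_on' with
  | add p q hp hq =>
    rw [map_add, Polynomial.eval_add, map_add, add_sub_add_comm]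
    exact Submodule.add_mem _ hp hq
  | monomial n c =>
    rcases eq_or_ne n 0 with rfl | hn
    · rw [Polynomial.monomial_zero_left, polyLr_C, Polynomial.eval_C, sub_self]
      exact Submodule.zero_mem _
    · set u := polyLr r (Polynomial.monomial n c)
      have hu : u ∈ hardyCircle hr hr1 := ⟨_, isHardyExtension_polyLr hr.le _⟩
      have hne : 1 - unitPt (α : Torus) ^ n ≠ 0 := sub_ne_zero.mpr (unitPt_pow_ne_one hα hn).symm
      have heigen : (LinearMap.id - rotOp r α : Lr r →ₗ[ℂ] Lr r) u =
          (1 - unitPt (α : Torus) ^ n) • u := by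
        rw [LinearMap.sub_apply, LinearMap.id_apply, rotOp_polyLr_monomial, sub_smul, one_smul]
      rw [Polynomial.eval_monomial, zero_pow hn, mul_zero, map_zero, sub_zero]
      refine ⟨(1 - unitPt (α : Torus) ^ n)⁻¹ • u, Submodule.smul_mem _ _ hu, ?_⟩
      rw [map_smul, heigen, inv_smul_smul₀ hne]

theorem exists_polynomial_norm_dilate_sub_lt (hF : DifferentiableOn ℂ F (Metric.ball 0 1)) {R : ℝ}
    (hR : R ∈ Set.Ico (0 : ℝ) 1) {δ : ℝ} (hδ : 0 < δ) :
    ∃ p : Polynomial ℂ, ∀ z : ℂ, ‖z‖ ≤ 1 → ‖F (R * z) - p.eval z‖ < δ := by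
  obtain ⟨a, ha, ha1⟩ := exists_between hR.2
  obtain ⟨b, hb, hb1⟩ := exists_between ha1
  have ha0 : 0 < a := hR.1.trans_lt ha
  lift a to NNReal using ha0.le
  lift b to NNReal using (ha0.trans hb).le
  have hps := (hF.mono (Metric.closedBall_subset_ball hb1)).hasFPowerSeriesOnBall
    (by exact_mod_cast ha0.trans hb)
  have hunif := hps.tendstoUniformlyOn (r' := a) (by exact_mod_cast hb)
  obtain ⟨n, hn⟩ := (Metric.tendstoUniformlyOn_iff.mp hunif δ hδ).exists
  set c := cauchyPowerSeries F 0 b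
  refine ⟨∑ k ∈ Finset.range n, Polynomial.monomial k (R ^ k * c.coeff k), fun z hz => ?_⟩
  have hRz : (R : ℂ) * z ∈ Metric.ball (0 : ℂ) a := by
    rw [mem_ball_zero_iff, norm_mul, Complex.norm_real, Real.norm_of_nonneg hR.1]
    exact (mul_le_of_le_one_right hR.1 hz).trans_lt ha
  have heval : (∑ k ∈ Finset.range n, Polynomial.monomial k (R ^ k * c.coeff k)).eval z =
      c.partialSum n (R * z) := by
    rw [Polynomial.eval_finsetSum, FormalMultilinearSeries.partialSum]
    refine Finset.sum_congr rfl fun k _ => ?_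
    rw [FormalMultilinearSeries.apply_eq_pow_smul_coeff, Polynomial.eval_monomial, smul_eq_mul,
      mul_pow]
    ring
  simpa only [heval, zero_add, dist_eq_norm] using hn _ hRz

theorem IsHardyExtension.exists_polynomial_lrDist_lt (hr : 0 < r) (hr1 : r < 1) {g : Lr r}
    (hF : IsHardyExtension r F g) {ε : ℝ} (hε : 0 < ε) : ∃ p, lrDist r g (polyLr r p) < ε := by
  have hlim := hF.1.tendsto_integral_dilate_sub hr hr1 (Lp.aestronglyMeasurable g)
    (integrable_norm_rpow hr g) hF.2
  obtain ⟨R, hlt, hR⟩ := ((hlim.eventually_lt_const (half_pos hε)).and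
    eventually_mem_Ico_nhdsLT_one).exists
  obtain ⟨p, hp⟩ := exists_polynomial_norm_dilate_sub_lt hF.1.1 hR
    (Real.rpow_pos_of_pos (half_pos hε) r⁻¹)
  refine ⟨p, ?_⟩
  have hFc := continuous_dilate hF.1.1 hR
  have hint : Integrable (fun t => ‖F (R * unitPt t) - g t‖ ^ r) mes :=
    integrable_norm_sub_rpow_of_integrable hr hr1 hFc.aestronglyMeasurable
      (Lp.aestronglyMeasurable g)
      (integrable_of_continuous (hFc.norm.rpow_const fun _ => Or.inr hr.le) _)
      (integrable_norm_rpow hr g)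
  calc lrDist r g (polyLr r p)
      ≤ ∫ t, (ε / 2 + ‖F (R * unitPt t) - g t‖ ^ r) ∂mes := by
        refine integral_mono_ae (integrable_norm_sub_rpow hr _ _)
          ((integrable_const _).add hint) ?_
        filter_upwards [coeFn_polyLr r p] with t ht
        have hunif : ‖F (R * unitPt t) - p.eval (unitPt t)‖ ^ r ≤ ε / 2 := by
          rw [← Real.le_rpow_inv_iff_of_pos (norm_nonneg _) (half_pos hε).le hr]
          exact (hp _ (norm_unitPt t).le).le
        have hsub := norm_sub_rpow_le hr hr1 (F (R * unitPt t) - p.eval (unitPt t))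
          (F (R * unitPt t) - g t)
        rw [sub_sub_sub_cancel_left] at hsub
        rw [ht]
        linarith
    _ = ε / 2 + ∫ t, ‖F (R * unitPt t) - g t‖ ^ r ∂mes := by
        rw [integral_add (integrable_const _) hint, integral_const, probReal_univ, one_smul]
    _ < ε := by linarith

theorem IsHardyExtension.sub_const_mem_lrClosure (hr : 0 < r) (hr1 : r < 1) {α : ℝ}
    (hα : ¬IsOfFinAddOrder (α : Torus)) {g : Lr r} (hF : IsHardyExtension r F g) :
    g - Lp.const (ENNReal.ofReal r) mes (F 0) ∈
      lrClosure hr hr1 (coboundaries r α (hardyCircle hr hr1)) := fun ε hε => by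
  obtain ⟨p, hp⟩ := hF.exists_polynomial_lrDist_lt hr hr1 (half_pos hε)
  refine ⟨_, polyLr_sub_const_mem_coboundaries hr hr1 hα p,
    (lrDist_sub_le hr hr1 _ _ _ _).trans_lt ?_⟩
  rw [lrDist_const]
  linarith [hF.norm_zero_sub_rpow_le_lrDist hr hr1 (isHardyExtension_polyLr hr.le p)]

end Polynomials

section Closedness

variable {r : ℝ}

theorem exists_seq_tendsto_ae_of_tendsto_integral_norm {X E : Type*} [MeasurableSpace X]
    [NormedAddCommGroup E] {μ : Measure X} {h : ℕ → X → E} (hh : ∀ n, Integrable (h n) μ)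
    (hlim : Tendsto (fun n => ∫ x, ‖h n x‖ ∂μ) atTop (𝓝 0)) :
    ∃ ns : ℕ → ℕ, StrictMono ns ∧
      ∀ᵐ x ∂μ, Tendsto (fun i => h (ns i) x) atTop (𝓝 0) := by
  refine TendstoInMeasure.exists_seq_tendsto_ae (g := 0) ?_
  refine tendstoInMeasure_of_tendsto_eLpNorm one_ne_zero (fun n => (hh n).1)
    aestronglyMeasurable_zero ?_
  simp only [sub_zero, eLpNorm_one_eq_lintegral_enorm,
    ← ofReal_integral_norm_eq_lintegral_enorm (hh _)]
  simpa using ENNReal.tendsto_ofReal hlim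

theorem tendsto_zero_of_tendsto_norm_rpow {E ι : Type*} [SeminormedAddCommGroup E] {l : Filter ι}
    {u : ι → E} (hr : 0 < r) (hu : Tendsto (fun i => ‖u i‖ ^ r) l (𝓝 0)) :
    Tendsto u l (𝓝 0) := by
  rw [tendsto_zero_iff_norm_tendsto_zero]
  simpa [Real.rpow_rpow_inv (norm_nonneg _) hr.ne', Real.zero_rpow (inv_ne_zero hr.ne')] using
    hu.rpow_const (p := r⁻¹) (Or.inr (inv_nonneg.mpr hr.le))

variable {f : ℕ → Lr r} {g : Lr r} {F : ℕ → ℂ → ℂ} {G : ℂ → ℂ}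

theorem uniformCauchySeqOn_of_tendsto_lrDist (hr : 0 < r) (hr1 : r < 1)
    (hF : ∀ n, IsHardyExtension r (F n) (f n))
    (hfg : Tendsto (fun n => lrDist r (f n) g) atTop (𝓝 0)) {ρ : ℝ} (hρ : ρ < 1) :
    UniformCauchySeqOn F atTop (Metric.closedBall 0 ρ) := by
  rw [Metric.uniformCauchySeqOn_iff]
  intro ε hε
  have hlim : Tendsto (fun n => (1 + ρ) / (1 - ρ) * lrDist r (f n) g) atTop (𝓝 0) := by
    simpa using hfg.const_mul ((1 + ρ) / (1 - ρ))
  obtain ⟨N, hN⟩ := eventually_atTop.mp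
    (hlim.eventually_lt_const (half_pos (Real.rpow_pos_of_pos hε r)))
  refine ⟨N, fun m hm n hn w hw => ?_⟩
  rw [mem_closedBall_zero_iff] at hw
  rw [dist_eq_norm, ← Real.rpow_lt_rpow_iff (norm_nonneg _) hε.le hr]
  calc ‖F m w - F n w‖ ^ r
      ≤ (1 + ‖w‖) / (1 - ‖w‖) * lrDist r (f m) (f n) :=
        (hF m).norm_sub_rpow_le_lrDist hr hr1 (hF n) (hw.trans_lt hρ)
    _ ≤ (1 + ρ) / (1 - ρ) * (lrDist r (f m) g + lrDist r (f n) g) := by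
        have hρ0 : 0 ≤ ρ := (norm_nonneg w).trans hw
        have := sub_pos.mpr hρ
        rw [lrDist_comm (f n) g]
        gcongr
        · exact lrDist_nonneg _ _
        · exact lrDist_triangle hr hr1 _ _ _
    _ < ε ^ r := by linarith [hN m hm, hN n hn]

theorem exists_tendstoLocallyUniformlyOn_of_tendsto_lrDist (hr : 0 < r) (hr1 : r < 1)
    (hF : ∀ n, IsHardyExtension r (F n) (f n))
    (hfg : Tendsto (fun n => lrDist r (f n) g) atTop (𝓝 0)) :
    ∃ G, TendstoLocallyUniformlyOn F G atTop (Metric.ball 0 1) := by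
  have hcauchy := fun ρ (hρ : ρ < 1) => uniformCauchySeqOn_of_tendsto_lrDist hr hr1 hF hfg hρ
  have hlim : ∀ w : ℂ, ‖w‖ < 1 → ∃ z, Tendsto (fun n => F n w) atTop (𝓝 z) := fun w hw =>
    cauchySeq_tendsto_of_complete
      ((hcauchy _ hw).cauchySeq (mem_closedBall_zero_iff.mpr le_rfl))
  choose! G hG using hlim
  refine ⟨G, tendstoLocallyUniformlyOn_of_forall_exists_nhds fun w hw => ?_⟩
  obtain ⟨ρ, hwρ, hρ⟩ := exists_between (mem_ball_zero_iff.mp hw)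
  refine ⟨Metric.closedBall 0 ρ, mem_nhdsWithin_of_mem_nhds
    (Metric.closedBall_mem_nhds_of_mem (mem_ball_zero_iff.mpr hwρ)), ?_⟩
  exact (hcauchy ρ hρ).tendstoUniformlyOn_of_tendsto fun z hz =>
    hG z ((mem_closedBall_zero_iff.mp hz).trans_lt hρ)

theorem norm_sub_rpow_le_of_tendsto_lrDist (hr : 0 < r) (hr1 : r < 1)
    (hF : ∀ n, IsHardyExtension r (F n) (f n))
    (hfg : Tendsto (fun n => lrDist r (f n) g) atTop (𝓝 0)) {w : ℂ} (hw : ‖w‖ < 1)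
    (hG : Tendsto (fun n => F n w) atTop (𝓝 (G w))) (n : ℕ) :
    ‖G w - F n w‖ ^ r ≤ ∫ t, ‖g t - f n t‖ ^ r ∂harmonicMeasure w := by
  have hint := fun u v : Lr r => integrable_harmonicMeasure hw (integrable_norm_sub_rpow hr u v)
  have hle : ∀ m, ‖F m w - F n w‖ ^ r ≤
      (1 + ‖w‖) / (1 - ‖w‖) * lrDist r (f m) g +
        ∫ t, ‖g t - f n t‖ ^ r ∂harmonicMeasure w := fun m =>
    calc ‖F m w - F n w‖ ^ r ≤ ∫ t, ‖f m t - f n t‖ ^ r ∂harmonicMeasure w :=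
          (hF m).norm_sub_rpow_le_integral hr hr1 (hF n) hw
      _ ≤ ∫ t, (‖f m t - g t‖ ^ r + ‖g t - f n t‖ ^ r) ∂harmonicMeasure w :=
          integral_mono (hint _ _) ((hint _ _).add (hint _ _)) fun t => by
            simpa only [sub_add_sub_cancel] using
              norm_add_rpow_le hr hr1 (f m t - g t) (g t - f n t)
      _ ≤ _ := by
          rw [integral_add (hint _ _) (hint _ _)]
          gcongr
          exact integral_harmonicMeasure_le hw (integrable_norm_sub_rpow hr _ _)
            fun _ => by positivity
  refine le_of_tendsto_of_tendsto' ((hG.sub_const (F n w)).norm.rpow_const (Or.inr hr.le)) ?_ hle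
  simpa using (hfg.const_mul ((1 + ‖w‖) / (1 - ‖w‖))).add_const _

theorem isRadialLimit_of_tendsto_lrDist (hr : 0 < r) (hr1 : r < 1)
    (hF : ∀ n, IsHardyExtension r (F n) (f n))
    (hfg : Tendsto (fun n => lrDist r (f n) g) atTop (𝓝 0))
    (hGF : ∀ n w, ‖w‖ < 1 → ‖G w - F n w‖ ^ r ≤ ∫ t, ‖g t - f n t‖ ^ r ∂harmonicMeasure w) :
    IsRadialLimit G g := by
  have hint : ∀ n, Integrable (fun t => ‖g t - f n t‖ ^ r) mes := fun n =>
    integrable_norm_sub_rpow hr g (f n)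
  obtain ⟨ns, -, hns⟩ := exists_seq_tendsto_ae_of_tendsto_integral_norm hint <| by
    refine hfg.congr fun n => (lrDist_comm _ _).trans ?_
    simp only [lrDist, Real.norm_of_nonneg (Real.rpow_nonneg (norm_nonneg _) r)]
  filter_upwards [hns, ae_all_iff.mpr fun n => (hF n).2,
    ae_all_iff.mpr fun n => ae_tendsto_integral_harmonicMeasure (hint n)] with t hsub hFt hfatou
  rw [← tendsto_sub_nhds_zero_iff]
  refine tendsto_zero_of_tendsto_norm_rpow hr (Metric.tendsto_nhds.mpr fun ε hε => ?_)
  obtain ⟨i, hi⟩ := (hsub.eventually_lt_const (half_pos hε)).exists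
  set n := ns i
  have hFn : Tendsto (fun R : ℝ => ‖F n (R * unitPt t) - f n t‖ ^ r) (𝓝[<] 1) (𝓝 0) := by
    simpa [Real.zero_rpow hr.ne'] using
      ((hFt n).sub_const (f n t)).norm.rpow_const (p := r) (Or.inr hr.le)
  have hbound := ((hfatou n).add hFn).add_const (‖g t - f n t‖ ^ r)
  filter_upwards [hbound.eventually_lt_const (show _ < ε by linarith),
    eventually_mem_Ico_nhdsLT_one] with R hlt hR
  rw [dist_zero_right, Real.norm_of_nonneg (by positivity)]
  have hG := hGF n (R * unitPt t) (norm_ofReal_mul_lt_one hR (norm_unitPt t).le)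
  have hadd := norm_add_rpow_le hr hr1 (G (R * unitPt t) - F n (R * unitPt t))
    (F n (R * unitPt t) - f n t)
  have hsub := norm_sub_rpow_le hr hr1 (G (R * unitPt t) - f n t) (g t - f n t)
  rw [sub_add_sub_cancel] at hadd
  rw [sub_sub_sub_cancel_right] at hsub
  linarith

theorem lrClosure_hardyCircle_le (hr : 0 < r) (hr1 : r < 1) :
    lrClosure hr hr1 (hardyCircle hr hr1) ≤ hardyCircle hr hr1 := fun g hg => by
  choose f hf hlt using fun n : ℕ => hg _ (Nat.one_div_pos_of_nat (n := n))
  have hfg : Tendsto (fun n => lrDist r (f n) g) atTop (𝓝 0) :=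
    squeeze_zero (fun n => lrDist_nonneg _ _) (fun n => (lrDist_comm _ _).trans_le (hlt n).le)
      tendsto_one_div_add_atTop_nhds_zero_nat
  choose F hF using hf
  obtain ⟨G, hG⟩ := exists_tendstoLocallyUniformlyOn_of_tendsto_lrDist hr hr1 hF hfg
  have hGF : ∀ n w, ‖w‖ < 1 → ‖G w - F n w‖ ^ r ≤ ∫ t, ‖g t - f n t‖ ^ r ∂harmonicMeasure w :=
    fun n w hw => norm_sub_rpow_le_of_tendsto_lrDist hr hr1 hF hfg hw
      (hG.tendsto_at (mem_ball_zero_iff.mpr hw)) n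
  have hint₀ := integrable_norm_sub_rpow hr g (f 0)
  have hint₁ := integrable_norm_rpow hr (f 0)
  refine ⟨G, memHardyDisc_of_le_integral_harmonicMeasure hr.le
    (hG.differentiableOn (Eventually.of_forall fun n => (hF n).1.1) Metric.isOpen_ball)
    (hint₀.add hint₁) fun w hw => ?_, isRadialLimit_of_tendsto_lrDist hr hr1 hF hfg hGF⟩
  have hadd := norm_add_rpow_le hr hr1 (G w - F 0 w) (F 0 w)
  rw [sub_add_cancel] at hadd
  simp only [Pi.add_apply]
  rw [integral_add (integrable_harmonicMeasure hw hint₀) (integrable_harmonicMeasure hw hint₁)]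
  have hF₀ := (hF 0).1.norm_rpow_le hr.le (Lp.aestronglyMeasurable (f 0)) hint₁ (hF 0).2 hw
  linarith [hGF 0 w hw]

end Closedness

section HittingTime

variable {X : Type*} {T : X → X} {U : Set X}

/-- The least `n` such that `T^n x ∈ U`, with the junk value `0` if there is none. -/
def hittingTime (T : X → X) (U : Set X) (x : X) : ℕ := sInf {n | T^[n] x ∈ U}

theorem hittingTime_le_of_mem {x : X} {n : ℕ} (h : T^[n] x ∈ U) : hittingTime T U x ≤ n :=
  Nat.sInf_le h

theorem hittingTime_of_mem {x : X} (hx : x ∈ U) : hittingTime T U x = 0 :=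
  Nat.le_zero.mp (hittingTime_le_of_mem (n := 0) hx)

theorem hittingTime_of_notMem {x : X} (hx : x ∉ U) (h : ∃ n, T^[n] x ∈ U) :
    hittingTime T U x = hittingTime T U (T x) + 1 := by
  refine (Nat.sInf_add (p := fun n => T^[n] x ∈ U) (n := 1) ?_).symm
  exact Nat.one_le_iff_ne_zero.mpr fun h0 =>
    (Nat.sInf_eq_zero.mp h0).elim hx (Set.Nonempty.ne_empty h)

theorem exists_forall_hittingTime_le [TopologicalSpace X] [CompactSpace X] (hT : Continuous T)
    (hU : IsOpen U) (h : ∀ x, ∃ n, T^[n] x ∈ U) : ∃ N, ∀ x, hittingTime T U x ≤ N := by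
  obtain ⟨s, hs⟩ := isCompact_univ.elim_finite_subcover (fun n => T^[n] ⁻¹' U)
    (fun n => hU.preimage (hT.iterate n)) fun x _ => Set.mem_iUnion.mpr (h x)
  refine ⟨s.sup id, fun x => ?_⟩
  obtain ⟨n, hn, hx⟩ := Set.mem_iUnion₂.mp (hs (Set.mem_univ x))
  exact (hittingTime_le_of_mem hx).trans (Finset.le_sup (f := id) hn)

theorem indicator_hittingTime_add_one (h : ∀ x, ∃ n, T^[n] x ∈ U) (x : X) :
    U.indicator (fun x => (hittingTime T U (T x) : ℝ) + 1) x =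
      (hittingTime T U (T x) : ℝ) + 1 - hittingTime T U x := by
  by_cases hx : x ∈ U
  · simp [hx, hittingTime_of_mem]
  · simp [hx, hittingTime_of_notMem hx (h x)]

variable [MeasurableSpace X]

theorem measurable_hittingTime (hT : Measurable T) (hU : MeasurableSet U)
    (h : ∀ x, ∃ n, T^[n] x ∈ U) : Measurable (hittingTime T U) := by
  classical
  have hfind : hittingTime T U = fun x => Nat.find (h x) := funext fun x => Nat.sInf_def (h x)
  rw [hfind]
  exact measurable_find h fun n => hT.iterate n hU

/-- Kac's formula. -/
theorem setIntegral_hittingTime_add_one {μ : Measure X} [IsFiniteMeasure μ]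
    (hT : MeasurePreserving T μ μ) (hU : MeasurableSet U) (h : ∀ x, ∃ n, T^[n] x ∈ U)
    (hint : Integrable (fun x => (hittingTime T U x : ℝ)) μ) :
    ∫ x in U, ((hittingTime T U (T x) : ℝ) + 1) ∂μ = μ.real Set.univ := by
  have hintT : Integrable (fun x => (hittingTime T U (T x) : ℝ)) μ :=
    hT.integrable_comp_of_integrable hint
  have hinv : ∫ x, (hittingTime T U (T x) : ℝ) ∂μ = ∫ x, (hittingTime T U x : ℝ) ∂μ := by
    have h := integral_map hT.aemeasurable (hT.map_eq.symm ▸ hint.1)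
    rw [hT.map_eq] at h
    exact h.symm
  rw [← integral_indicator hU,
    integral_congr_ae (Eventually.of_forall (indicator_hittingTime_add_one h)),
    integral_sub (by fun_prop) hint, integral_add hintT (integrable_const 1), hinv]
  simp

theorem integral_rpow_le {μ : Measure X} [IsFiniteMeasure μ] {r : ℝ} (hr : 0 ≤ r) (hr1 : r ≤ 1)
    {f : X → ℝ} (hf : Integrable f μ) (h0 : ∀ x, 0 ≤ f x) :
    ∫ x, f x ^ r ∂μ ≤ μ.real Set.univ ^ (1 - r) * (∫ x, f x ∂μ) ^ r := by
  have hfr : Integrable (fun x => f x ^ r) μ := by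
    have h := ((memLp_one_iff_integrable.mpr hf).mono_exponent
      (ENNReal.ofReal_le_one.mpr hr1)).integrable_norm_rpow'
    simpa only [ENNReal.toReal_ofReal hr, Real.norm_of_nonneg (h0 _)] using h
  rcases eq_zero_or_neZero μ with rfl | hμ
  · simpa using by positivity
  have hJensen : ⨍ x, f x ^ r ∂μ ≤ (⨍ x, f x ∂μ) ^ r :=
    (Real.concaveOn_rpow hr hr1).le_map_average
      (continuousOn_id.rpow_const fun _ _ => Or.inr hr) isClosed_Ici
      (Eventually.of_forall h0) hf hfr
  have hμ0 : 0 < μ.real Set.univ := measureReal_univ_pos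
  rw [average_eq, average_eq, smul_eq_mul, smul_eq_mul, inv_mul_le_iff₀ hμ0,
    Real.mul_rpow (by positivity) (integral_nonneg h0), Real.inv_rpow hμ0.le, ← mul_assoc,
    ← div_eq_mul_inv] at hJensen
  rwa [Real.rpow_sub hμ0, Real.rpow_one]

end HittingTime

theorem exists_iterate_add_right_mem {a : Torus} (ha : ¬IsOfFinAddOrder a) {U : Set Torus}
    (hU : IsOpen U) (hne : U.Nonempty) (x : Torus) : ∃ n, (· + a)^[n] x ∈ U := by
  have hdense : DenseRange (· • a : ℕ → Torus) :=
    denseRange_zsmul_iff_nsmul.mp (AddCircle.denseRange_zsmul_iff.mpr (addOrderOf_eq_zero ha))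
  obtain ⟨u, hu⟩ := hne
  obtain ⟨n, hn⟩ := hdense.exists_mem_open (hU.preimage (continuous_const_add x))
    ⟨-x + u, by simpa using hu⟩
  exact ⟨n, by simpa using hn⟩

theorem lrDist_one_sub_rotOp_eq {r : ℝ} (hr : r ≠ 0) {α : ℝ} {U : Set Torus}
    (hU : MeasurableSet U) (h : ∀ x, ∃ n, (· + (α : Torus))^[n] x ∈ U) {f : Lr r}
    (hf : f =ᵐ[mes] fun x => (hittingTime (· + (α : Torus)) U x : ℂ)) :
    lrDist r (Lp.const (ENNReal.ofReal r) mes 1) (f - rotOp r α f) =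
      ∫ x in U, ((hittingTime (· + (α : Torus)) U (x + α) : ℝ) + 1) ^ r ∂mes := by
  have hrot := (coeFn_rotOp r α f).trans
    ((measurePreserving_add_right mes (α : Torus)).quasiMeasurePreserving.ae_eq_comp hf)
  rw [lrDist_congr (Lp.coeFn_const _ _ 1) ((Lp.coeFn_sub f _).trans (hf.sub hrot)),
    ← integral_indicator hU]
  refine integral_congr_ae (Eventually.of_forall fun x => ?_)
  set n := hittingTime (· + (α : Torus)) U
  have hreal : (1 : ℂ) - (n x - n (x + α)) =
      (U.indicator (fun x => (n (x + α) : ℝ) + 1) x : ℝ) := by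
    rw [indicator_hittingTime_add_one h x]
    push_cast
    ring
  simp only [Function.const_apply, Pi.sub_apply, Function.comp_apply, hreal, Complex.norm_real]
  by_cases hx : x ∈ U
  · simp only [hx, Set.indicator_of_mem]
    rw [Real.norm_of_nonneg (by positivity)]
  · simp [hx, Real.zero_rpow hr]

theorem exists_lrDist_one_sub_rotOp_le {r : ℝ} (hr : 0 < r) (hr1 : r < 1) {α : ℝ}
    (hα : ¬IsOfFinAddOrder (α : Torus)) {U : Set Torus} (hU : IsOpen U) (hne : U.Nonempty) :
    ∃ f : Lr r, lrDist r (Lp.const (ENNReal.ofReal r) mes 1) (f - rotOp r α f) ≤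
      mes.real U ^ (1 - r) := by
  have hT : MeasurePreserving (· + (α : Torus)) mes mes := measurePreserving_add_right mes α
  have hret := exists_iterate_add_right_mem hα hU hne
  obtain ⟨N, hN⟩ := exists_forall_hittingTime_le (continuous_add_const (α : Torus)) hU hret
  have hmeas := measurable_hittingTime hT.measurable hU.measurableSet hret
  have hint : Integrable (fun x => (hittingTime (· + (α : Torus)) U x : ℝ)) mes :=
    Integrable.of_bound (by fun_prop) N (Eventually.of_forall fun x => by simpa using hN x)
  have hmem : MemLp (fun x => (hittingTime (· + (α : Torus)) U x : ℂ)) (ENNReal.ofReal r) mes :=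
    MemLp.of_bound (by fun_prop) N (Eventually.of_forall fun x => by simpa using hN x)
  have hkac := setIntegral_hittingTime_add_one hT hU.measurableSet hret hint
  refine ⟨hmem.toLp, ?_⟩
  rw [lrDist_one_sub_rotOp_eq hr.ne' hU.measurableSet hret hmem.coeFn_toLp]
  refine (integral_rpow_le hr.le hr1.le ((hT.integrable_comp_of_integrable hint).add
    (integrable_const 1)).integrableOn fun x => by
      simp only [Pi.add_apply, Function.comp_apply]; positivity).trans_eq ?_
  simp only [Pi.add_apply, Function.comp_apply, hkac, measureReal_restrict_apply_univ]
  simp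

theorem one_mem_lrClosure_coboundaries_top {r : ℝ} (hr : 0 < r) (hr1 : r < 1) {α : ℝ}
    (hα : ¬IsOfFinAddOrder (α : Torus)) :
    Lp.const (ENNReal.ofReal r) mes (1 : ℂ) ∈ lrClosure hr hr1 (coboundaries r α ⊤) := by
  intro ε hε
  set δ := ε ^ (1 - r)⁻¹
  have hδ : 0 < δ := Real.rpow_pos_of_pos hε _
  have hmeasure : mes.real (Metric.ball 0 (δ / 2)) < δ :=
    ((measureReal_mono Metric.ball_subset_closedBall).trans
      (measureReal_closedBall_le 0 (half_pos hδ).le)).trans_lt (half_lt_self hδ)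
  obtain ⟨f, hf⟩ := exists_lrDist_one_sub_rotOp_le hr hr1 hα Metric.isOpen_ball
    ⟨0, Metric.mem_ball_self (half_pos hδ)⟩
  refine ⟨_, ⟨f, trivial, rfl⟩, hf.trans_lt ?_⟩
  rwa [← Real.lt_rpow_inv_iff_of_pos measureReal_nonneg hε.le (sub_pos.mpr hr1)]

theorem lrClosure_mono {r : ℝ} (hr : 0 < r) (hr1 : r < 1) {V W : Submodule ℂ (Lr r)}
    (h : V ≤ W) : lrClosure hr hr1 V ≤ lrClosure hr hr1 W := fun _ hg ε hε =>
  (hg ε hε).imp fun _ hf => hf.imp_left fun hfV => h hfV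

end HardyRotation

end

open HardyRotation in
theorem theorem3p1_general (r : ℝ) (hr : 0 < r) (hr1 : r < 1) (α : ℝ)
    (hα : Irrational (α / (2 * Real.pi))) :
    constants r ⊔ lrClosure hr hr1 (coboundaries r α (hardyCircle hr hr1)) = hardyCircle hr hr1 ∧
    Disjoint (constants r) (lrClosure hr hr1 (coboundaries r α (hardyCircle hr hr1))) ∧
    Lp.const (ENNReal.ofReal r) mes (1 : ℂ) ∉
      lrClosure hr hr1 (coboundaries r α (hardyCircle hr hr1)) ∧
    Lp.const (ENNReal.ofReal r) mes (1 : ℂ) ∈ lrClosure hr hr1 (coboundaries r α ⊤) := by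
  have ha : ¬IsOfFinAddOrder (α : Torus) := addOrderOf_eq_zero_iff.mp
    (AddCircle.denseRange_zsmul_iff.mp (AddCircle.denseRange_zsmul_coe_iff.mpr hα))
  refine ⟨le_antisymm (sup_le (constants_le_hardyCircle hr hr1) ?_) ?_, ?_, ?_,
    one_mem_lrClosure_coboundaries_top hr hr1 ha⟩
  · exact (lrClosure_mono hr hr1 (coboundaries_le_hardyCircle hr hr1 α)).trans
      (lrClosure_hardyCircle_le hr hr1)
  · rintro g ⟨F, hF⟩
    rw [← add_sub_cancel (Lp.const (ENNReal.ofReal r) mes (F 0)) g]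
    exact Submodule.add_mem_sup ⟨F 0, rfl⟩
      (IsHardyExtension.sub_const_mem_lrClosure hr hr1 ha hF)
  · rw [Submodule.disjoint_def]
    rintro _ ⟨c, rfl⟩ hc
    rw [eq_zero_of_const_mem_lrClosure_coboundaries hr hr1 hc, map_zero]
  · exact fun h => one_ne_zero (eq_zero_of_const_mem_lrClosure_coboundaries hr hr1 h)

theorem theorem3p1 (r : ℝ) (hr : 0 < r) (hr1 : r < 1) (α : ℝ)
    (hα : Irrational (α / (2 * Real.pi))) :
    -- `H^r(𝕋)` is the sum of the constants and the closure of `(I - T) H^r(𝕋)` ...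
    HardyRotation.constants r ⊔
        HardyRotation.lrClosure hr hr1
          (HardyRotation.coboundaries r α (HardyRotation.hardyCircle hr hr1)) =
      HardyRotation.hardyCircle hr hr1 ∧
    -- ... and the sum is direct;
    Disjoint (HardyRotation.constants r)
      (HardyRotation.lrClosure hr hr1
        (HardyRotation.coboundaries r α (HardyRotation.hardyCircle hr hr1))) ∧
    -- in particular the constant function `1` is not in that closure,
    MeasureTheory.Lp.const (ENNReal.ofReal r) HardyRotation.mes (1 : ℂ) ∉
      HardyRotation.lrClosure hr hr1
        (HardyRotation.coboundaries r α (HardyRotation.hardyCircle hr hr1)) ∧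
    -- whereas for `r < 1/3` it is in the closure of `(I - T) L^r(𝕋)`.
    (r < 1 / 3 →
      MeasureTheory.Lp.const (ENNReal.ofReal r) HardyRotation.mes (1 : ℂ) ∈
        HardyRotation.lrClosure hr hr1 (HardyRotation.coboundaries r α ⊤)) := by
  obtain ⟨hsum, hdisj, hnotMem, hmem⟩ := theorem3p1_general r hr hr1 α hα
  exact ⟨hsum, hdisj, hnotMem, fun _ => hmem⟩
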